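/- **Theorem 1.** Graphs are finite and undirected, possibly with loops and parallel edges; a loop counts twice in the degree of its vertex. A graph $G=(V,E)$ is the *homomorphic image* of a graph $H=(W,F)$ by an onto function $\varphi:W\to V$ if for any two vertices $u,v\in V$ (possibly $u=v$) the number of edges of $G$ between $u$ and $v$ equals the number of edges of $H$ whose endpoints are mapped by $\varphi$ to $\{u,v\}$. For an integer $k>0$, $G$ is a *$k$-trail* if it is the homomorphic image of a connected graph of maximum degree at most $k$, and a *$k$-tree* is a tree of maximum degree at most $k$. There is a polynomial-time algorithm that, given a connected graph $G=(V,E)$ with at least two vertices and an integer $k>0$ (written in binary), decides whether $G$ is a $k$-trail and, if it is, outputs a $k$-tree $H=(W,F)$ and an onto function $\varphi:W\to V$ such that $G$ is the homomorphic image of $H$ by $\varphi$. (Here an algorithm is a random access machine program with addition and truncated subtraction as its only arithmetic operations, each operation having unit cost, and polynomial time means at most $p(|V|+|E|+\lceil\log_2(k+1)\rceil)$ for a fixed polynomial $p$.) -/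

import Mathlib

/-! ### Finite multigraphs, homomorphic images, `k`-trails and `k`-trees

Undirected graphs with possible loops and parallel edges are Mathlib's `Graph α β`
(vertices in `α`, edges in `β`). -/

namespace KTrail

open Graph

/-- The degree of a vertex: the number of edges incident with it, loops being counted twice. -/
noncomputable def degree {α β : Type*} (G : Graph α β) (v : α) : ℕ :=
  {e | G.Inc e v}.ncard + {e | G.IsLoopAt e v}.ncard

/-- Connectedness (which includes having at least one vertex). Loops and parallel edges do not
matter for it, so it is read off the underlying simple graph. -/
def IsConnected {α β : Type*} (G : Graph α β) : Prop :=
  G.toSimpleGraph.Connected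

/-- All degrees are at most `k`. -/
def MaxDegreeLE {α β : Type*} (G : Graph α β) (k : ℕ) : Prop :=
  ∀ v ∈ V(G), degree G v ≤ k

/-- Trees: no loops, no parallel edges, and the underlying simple graph is a tree. -/
def IsTree {α β : Type*} (G : Graph α β) : Prop :=
  G.Simple ∧ G.toSimpleGraph.IsTree

/-- `k`-trees: trees of maximum degree at most `k`. -/
def IsKTree {α β : Type*} (G : Graph α β) (k : ℕ) : Prop :=
  IsTree G ∧ MaxDegreeLE G k

/-- `G` is the homomorphic image of `H` by `φ`: the function `φ` maps the vertices of `H` onto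
those of `G`, and for any two (possibly equal) vertices `u`, `v` of `G`, the number of edges of `G`
between `u` and `v` is the number of edges of `H` whose ends are mapped by `φ` to `u` and `v`. -/
structure IsHomImageBy {α β γ δ : Type*} (G : Graph α β) (H : Graph γ δ) (φ : γ → α) : Prop where
  image_eq : φ '' V(H) = V(G)
  ncard_eq : ∀ u ∈ V(G), ∀ v ∈ V(G),
    {e | G.IsLink e u v}.ncard = {f | ∃ x y, H.IsLink f x y ∧ s(φ x, φ y) = s(u, v)}.ncard

/-- `G` is a `k`-trail: it is the homomorphic image of a finite connected graph of maximum degree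
at most `k`. -/
def IsKTrail {α β : Type*} (G : Graph α β) (k : ℕ) : Prop :=
  ∃ (γ δ : Type) (H : Graph γ δ) (φ : γ → α),
    V(H).Finite ∧ E(H).Finite ∧ IsConnected H ∧ MaxDegreeLE H k ∧ IsHomImageBy G H φ

/-- A finite multigraph as an algorithm sees it: `n` vertices `0, …, n - 1` and a list of `m` edges,
each given by its two ends. -/
structure EdgeList where
  /-- the number of vertices -/
  n : ℕ
  /-- the number of edges -/
  m : ℕ
  /-- the two ends of each edge -/
  ends : Fin m → Fin n × Fin n

/-- The multigraph described by an edge list. -/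
def EdgeList.toGraph (G : EdgeList) : Graph (Fin G.n) (Fin G.m) where
  vertexSet := Set.univ
  edgeSet := Set.univ
  IsLink e x y := s((G.ends e).1, (G.ends e).2) = s(x, y)
  isLink_symm := fun _ _ => ⟨fun _ _ h => h.trans Sym2.eq_swap⟩
  eq_or_eq_of_isLink_of_isLink := fun e x y v w h h' => by
    have hh := h.symm.trans h'
    rw [Sym2.eq_iff] at hh
    tauto
  edge_mem_iff_exists_isLink := fun e => ⟨fun _ => ⟨_, _, rfl⟩, fun _ => trivial⟩
  left_mem_of_isLink := fun _ _ _ _ => trivial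

end KTrail

/-! ### Random access machines

Programs of a random access machine whose memory cells hold natural numbers, in structured form.
The memory consists of scalar registers and of arrays; a program mentions finitely many of either.
The arithmetic is addition and truncated subtraction only. Every operation has unit cost; since
there is no multiplication, the lengths of the numbers in memory grow by at most a constant in every
unit of time, so that polynomial time on this machine is polynomial time on Turing machines. -/

namespace Ram

/-- The contents of the memory. -/
structure State where
  /-- the scalar registers -/
  reg : ℕ → ℕ
  /-- the arrays: `arr a i` is entry `i` of array `a` -/
  arr : ℕ → ℕ → ℕ

/-- Arithmetic expressions. -/
inductive Expr where
  /-- a constant -/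
  | const (c : ℕ)
  /-- the contents of a register -/
  | reg (r : ℕ)
  /-- the entry of an array at a computed index -/
  | get (a : ℕ) (idx : Expr)
  /-- sum -/
  | add (x y : Expr)
  /-- difference, zero if negative -/
  | sub (x y : Expr)

/-- The value of an expression. -/
def Expr.eval (s : State) : Expr → ℕ
  | .const c => c
  | .reg r => s.reg r
  | .get a idx => s.arr a (idx.eval s)
  | .add x y => x.eval s + y.eval s
  | .sub x y => x.eval s - y.eval s

/-- The time it takes to evaluate an expression: the number of operations in it. -/
def Expr.cost : Expr → ℕ
  | .const _ => 1
  | .reg _ => 1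
  | .get _ idx => idx.cost + 1
  | .add x y => x.cost + y.cost + 1
  | .sub x y => x.cost + y.cost + 1

/-- Programs. -/
inductive Prog where
  /-- do nothing -/
  | skip
  /-- write the value of an expression into a register -/
  | assign (r : ℕ) (x : Expr)
  /-- write the value of `x` into array `a` at the index given by `idx` -/
  | store (a : ℕ) (idx x : Expr)
  /-- run `P`, then `Q` -/
  | seq (P Q : Prog)
  /-- run `P` if the value of `x` is non-zero, and `Q` otherwise -/
  | cond (x : Expr) (P Q : Prog)
  /-- run `P` as long as the value of `x` is non-zero -/
  | loop (x : Expr) (P : Prog)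

/-- The memory after writing `c` into register `r`. -/
def State.setReg (s : State) (r c : ℕ) : State :=
  { s with reg := Function.update s.reg r c }

/-- The memory after writing `c` into array `a` at index `i`. -/
def State.setArr (s : State) (a i c : ℕ) : State :=
  { s with arr := Function.update s.arr a (Function.update (s.arr a) i c) }

/-- `Runs P s t s'`: the program `P`, started with memory `s`, halts after time `t` with
memory `s'`. -/
inductive Runs : Prog → State → ℕ → State → Prop where
  | skip (s : State) : Runs .skip s 1 s
  | assign (r : ℕ) (x : Expr) (s : State) :
      Runs (.assign r x) s (x.cost + 1) (s.setReg r (x.eval s))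
  | store (a : ℕ) (idx x : Expr) (s : State) :
      Runs (.store a idx x) s (idx.cost + x.cost + 1) (s.setArr a (idx.eval s) (x.eval s))
  | seq {P Q : Prog} {s₁ s₂ s₃ : State} {t u : ℕ} :
      Runs P s₁ t s₂ → Runs Q s₂ u s₃ → Runs (.seq P Q) s₁ (t + u) s₃
  | cond_true {x : Expr} {P Q : Prog} {s₁ s₂ : State} {t : ℕ} :
      x.eval s₁ ≠ 0 → Runs P s₁ t s₂ → Runs (.cond x P Q) s₁ (x.cost + 1 + t) s₂
  | cond_false {x : Expr} {P Q : Prog} {s₁ s₂ : State} {t : ℕ} :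
      x.eval s₁ = 0 → Runs Q s₁ t s₂ → Runs (.cond x P Q) s₁ (x.cost + 1 + t) s₂
  | loop_true {x : Expr} {P : Prog} {s₁ s₂ s₃ : State} {t u : ℕ} :
      x.eval s₁ ≠ 0 → Runs P s₁ t s₂ → Runs (.loop x P) s₂ u s₃ →
        Runs (.loop x P) s₁ (x.cost + 1 + t + u) s₃
  | loop_false {x : Expr} {P : Prog} {s : State} :
      x.eval s = 0 → Runs (.loop x P) s (x.cost + 1) s

end Ram

namespace KTrail

/-- The memory that a program finds on input `(G, k)`: register `0` holds `k`, registers `1` and `2`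
hold the numbers of vertices and edges of `G`, arrays `0` and `1` hold the two ends of the edges,
and everything else is zero. -/
def inputState (G : EdgeList) (k : ℕ) : Ram.State where
  reg r := if r = 0 then k else if r = 1 then G.n else if r = 2 then G.m else 0
  arr a e :=
    if h : e < G.m then
      if a = 0 then (G.ends ⟨e, h⟩).1 else if a = 1 then (G.ends ⟨e, h⟩).2 else 0
    else 0

/-- The length of the input `(G, k)`: the number of vertices plus the number of edges plus the
number of binary digits of `k`. -/
def inputSize (G : EdgeList) (k : ℕ) : ℕ :=
  G.n + G.m + k.size

/-- The memory `s` contains, in the input format, the graph `H`, and in array `2` the values of the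
map `φ` on the vertices of `H`. -/
def Outputs (s : Ram.State) (H : EdgeList) {n : ℕ} (φ : Fin H.n → Fin n) : Prop :=
  s.reg 1 = H.n ∧ s.reg 2 = H.m ∧
    (∀ e : Fin H.m, s.arr 0 e = (H.ends e).1 ∧ s.arr 1 e = (H.ends e).2) ∧
    ∀ w : Fin H.n, s.arr 2 w = φ w

end KTrail

/-
A tree over `G` that is rooted at a copy of the vertex `0` and directed away from its root orients
`G` so that every vertex is reachable from `0`; a vertex `v` then has `indeg v + [v = 0]` copies.
Conversely, every such orientation comes from a tree, and as edges can be moved between copies of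
the same vertex, the tree can be made a `k`-tree as soon as `deg v ≤ k * copies v` for all `v`.

Such an orientation is found by local search: if `v` lacks copies and `u` has one to spare, reverse
a path from `v` to `u` unless this destroys reachability. If nothing can be traded although `v`
lacks copies, then every `u` with a spare copy lies in a tight set, entered by as few edges as
reachability allows, that avoids `v`. By submodularity the maximal such sets are disjoint, and
contracting them leaves too few edges for a connected graph of maximum degree at most `k` over `G`.
-/

namespace Ram

/-! ### A program logic -/

attribute [simp] Expr.eval

/-- Whether a program contains no write to register `r`. -/
def Prog.keepsReg (r : ℕ) : Prog → Bool
  | .skip => true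
  | .assign r' _ => r' != r
  | .store _ _ _ => true
  | .seq P Q => P.keepsReg r && Q.keepsReg r
  | .cond _ P Q => P.keepsReg r && Q.keepsReg r
  | .loop _ P => P.keepsReg r

/-- Whether a program contains no write to array `a`. -/
def Prog.keepsArr (a : ℕ) : Prog → Bool
  | .skip => true
  | .assign _ _ => true
  | .store a' _ _ => a' != a
  | .seq P Q => P.keepsArr a && Q.keepsArr a
  | .cond _ P Q => P.keepsArr a && Q.keepsArr a
  | .loop _ P => P.keepsArr a

/-- The memories `s` and `s'` agree on all registers and arrays to which `P` does not write. -/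
structure Frame (P : Prog) (s s' : State) : Prop where
  reg : ∀ r, P.keepsReg r = true → s'.reg r = s.reg r
  arr : ∀ a, P.keepsArr a = true → s'.arr a = s.arr a

theorem Frame.refl (P : Prog) (s : State) : Frame P s s :=
  ⟨fun _ _ => rfl, fun _ _ => rfl⟩

theorem Frame.trans {P : Prog} {s s' s'' : State} (h : Frame P s s') (h' : Frame P s' s'') :
    Frame P s s'' :=
  ⟨fun r hr => (h'.reg r hr).trans (h.reg r hr), fun a ha => (h'.arr a ha).trans (h.arr a ha)⟩

@[simp]
theorem State.setReg_reg (s : State) (r c r' : ℕ) :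
    (s.setReg r c).reg r' = if r' = r then c else s.reg r' := by
  simp [State.setReg, Function.update_apply]

@[simp]
theorem State.setReg_arr (s : State) (r c a : ℕ) : (s.setReg r c).arr a = s.arr a := rfl

@[simp]
theorem State.setArr_reg (s : State) (a i c r : ℕ) : (s.setArr a i c).reg r = s.reg r := rfl

@[simp]
theorem State.setArr_arr (s : State) (a i c a' : ℕ) :
    (s.setArr a i c).arr a' = if a' = a then Function.update (s.arr a) i c else s.arr a' := by
  simp [State.setArr, Function.update_apply]

theorem Runs.frame {P : Prog} {s s' : State} {t : ℕ} (h : Runs P s t s') : Frame P s s' := by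
  induction h with
  | skip => exact .refl _ _
  | assign r x s =>
    refine ⟨fun r' hr => ?_, fun _ _ => rfl⟩
    have : r ≠ r' := by simpa [Prog.keepsReg] using hr
    simp [this.symm]
  | store a idx x s =>
    refine ⟨fun _ _ => rfl, fun a' ha => ?_⟩
    have : a ≠ a' := by simpa [Prog.keepsArr] using ha
    simp [this.symm]
  | seq _ _ ih₁ ih₂ =>
    constructor <;> simp_all [Prog.keepsReg, Prog.keepsArr, ih₁.reg, ih₁.arr, ih₂.reg, ih₂.arr]
  | cond_true _ _ ih | cond_false _ _ ih =>
    constructor <;> simp_all [Prog.keepsReg, Prog.keepsArr, ih.reg, ih.arr]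
  | loop_true _ _ _ ih₁ ih₂ => exact Frame.trans ⟨ih₁.reg, ih₁.arr⟩ ih₂
  | loop_false => exact .refl _ _

/-- A bound on the running time of a program all of whose loops are iterated at most `L` times.
It lives in an arbitrary semiring, so that it can be read off as a polynomial. -/
def Prog.time {R : Type*} [Semiring R] (L : R) : Prog → R
  | .skip => 1
  | .assign _ x => x.cost + 1
  | .store _ idx x => idx.cost + x.cost + 1
  | .seq P Q => P.time L + Q.time L
  | .cond x P Q => x.cost + 1 + (P.time L + Q.time L)
  | .loop x P => (L + 1) * (x.cost + 1 + P.time L)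

theorem Prog.eval_time (P : Prog) (p : Polynomial ℕ) (N : ℕ) :
    (P.time p).eval N = P.time (p.eval N) := by
  induction P <;> simp_all [Prog.time]

/-- Total correctness: started in memory `s`, the program `P` halts with a memory satisfying `Q`,
within the time that results from iterating every loop at most `L` times. -/
def Halts (L : ℕ) (P : Prog) (s : State) (Q : State → Prop) : Prop :=
  ∃ t s', Runs P s t s' ∧ t ≤ P.time L ∧ Q s'

variable {L : ℕ} {P P' : Prog} {s : State} {Q Q' : State → Prop} {x : Expr}

theorem Halts.mono (h : Halts L P s Q) (hQ : ∀ s', Q s' → Q' s') : Halts L P s Q' :=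
  let ⟨t, s', h₁, h₂, h₃⟩ := h
  ⟨t, s', h₁, h₂, hQ s' h₃⟩

theorem Halts.frame (h : Halts L P s Q) : Halts L P s fun s' => Q s' ∧ Frame P s s' :=
  let ⟨t, s', h₁, h₂, h₃⟩ := h
  ⟨t, s', h₁, h₂, h₃, h₁.frame⟩

theorem Halts.seq (h : Halts L P s Q') (h' : ∀ s', Q' s' → Halts L P' s' Q) :
    Halts L (.seq P P') s Q := by
  obtain ⟨t, s', h₁, h₂, h₃⟩ := h
  obtain ⟨t', s'', h₁', h₂', h₃'⟩ := h' s' h₃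
  exact ⟨_, _, .seq h₁ h₁', Nat.add_le_add h₂ h₂', h₃'⟩

theorem Halts.cond (h : x.eval s ≠ 0 → Halts L P s Q) (h' : x.eval s = 0 → Halts L P' s Q) :
    Halts L (.cond x P P') s Q := by
  by_cases hx : x.eval s = 0
  · obtain ⟨t, s', h₁, h₂, h₃⟩ := h' hx
    exact ⟨_, _, .cond_false hx h₁, by simp only [Prog.time, Nat.cast_id]; omega, h₃⟩
  · obtain ⟨t, s', h₁, h₂, h₃⟩ := h hx
    exact ⟨_, _, .cond_true hx h₁, by simp only [Prog.time, Nat.cast_id]; omega, h₃⟩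

/-- Whether a program contains no loop. -/
def Prog.loopFree : Prog → Bool
  | .seq P Q => P.loopFree && Q.loopFree
  | .cond _ P Q => P.loopFree && Q.loopFree
  | .loop _ _ => false
  | _ => true

/-- The final memory of a loop-free program (loops are skipped). -/
@[simp]
def Prog.exec : Prog → State → State
  | .skip, s => s
  | .assign r x, s => s.setReg r (x.eval s)
  | .store a idx x, s => s.setArr a (idx.eval s) (x.eval s)
  | .seq P Q, s => Q.exec (P.exec s)
  | .cond x P Q, s => if x.eval s = 0 then Q.exec s else P.exec s
  | .loop _ _, s => s

theorem Halts.exec (hP : P.loopFree = true) (hQ : Q (P.exec s)) : Halts L P s Q := by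
  refine Halts.mono (Q := (· = P.exec s)) ?_ fun _ h => h ▸ hQ
  clear hQ
  induction P generalizing s with
  | skip => exact ⟨_, _, .skip s, by simp [Prog.time], rfl⟩
  | assign r x => exact ⟨_, _, .assign r x s, by simp [Prog.time], rfl⟩
  | store a idx x => exact ⟨_, _, .store a idx x s, by simp [Prog.time], rfl⟩
  | seq P P' ih ih' =>
    rw [Prog.loopFree, Bool.and_eq_true] at hP
    exact (ih hP.1).seq fun s' h => h ▸ ih' hP.2
  | cond x P P' ih ih' =>
    rw [Prog.loopFree, Bool.and_eq_true] at hP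
    exact .cond (fun h => by simpa [h] using ih hP.1) (fun h => by simpa [h] using ih' hP.2)
  | loop => cases hP

theorem Halts.exec_seq (hP : P.loopFree = true) (h : Halts L P' (P.exec s) Q) :
    Halts L (.seq P P') s Q :=
  .seq (Q' := (· = P.exec s)) (.exec hP rfl) fun _ hs => hs ▸ h

theorem Frame.exec (hP : P.loopFree = true) (s : State) : Frame P s (P.exec s) :=
  let ⟨_, _, h, _, hs⟩ := Halts.exec (L := 0) (Q := (· = P.exec s)) hP rfl
  hs ▸ h.frame

section Loop

variable {α : Type*} {Inv : α → State → Prop} {μ : α → State → ℕ}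

theorem Runs.exists_loop {n : ℕ} {a : α}
    (hstep : ∀ a s, Inv a s → x.eval s ≠ 0 →
      Halts L P s fun s' => ∃ a', Inv a' s' ∧ μ a' s' < μ a s)
    (h0 : Inv a s) (hμ : μ a s ≤ n) :
    ∃ t s', Runs (.loop x P) s t s' ∧ t ≤ (n + 1) * (x.cost + 1 + P.time L) ∧
      ∃ a', Inv a' s' ∧ x.eval s' = 0 := by
  induction n generalizing a s with
  | zero =>
    by_cases hx : x.eval s = 0
    · exact ⟨_, s, .loop_false hx, by linarith [Nat.zero_le (P.time L)], a, h0, hx⟩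
    · obtain ⟨t, s', _, _, a', _, h⟩ := hstep a s h0 hx
      omega
  | succ n ih =>
    by_cases hx : x.eval s = 0
    · exact ⟨_, s, .loop_false hx, by
        nlinarith [Nat.zero_le (P.time L), Nat.zero_le (n * (x.cost + 1 + P.time L))], a, h0, hx⟩
    · obtain ⟨t, s', h₁, h₂, a', h₃, h₄⟩ := hstep a s h0 hx
      obtain ⟨t', s'', h₁', h₂', h₃'⟩ := ih h₃ (by omega)
      exact ⟨_, s'', .loop_true hx h₁ h₁', by nlinarith, h₃'⟩

/-- The loop rule. The invariant and the measure may depend on a ghost value `a : α`, such as a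
mathematical object represented in memory, that changes with every iteration. -/
theorem Halts.loop (Inv : α → State → Prop) (μ : α → State → ℕ)
    (hstep : ∀ a s', Inv a s' → Frame P s s' → x.eval s' ≠ 0 →
      Halts L P s' fun s'' => ∃ a', Inv a' s'' ∧ μ a' s'' < μ a s')
    {a : α} (h0 : Inv a s) (hμ : μ a s ≤ L)
    (hQ : ∀ a s', Inv a s' → Frame P s s' → x.eval s' = 0 → Q s') :
    Halts L (.loop x P) s Q := by
  obtain ⟨t, s', h₁, h₂, a', ⟨h₃, h₄⟩, h₅⟩ := Runs.exists_loop
    (Inv := fun a s' => Inv a s' ∧ Frame P s s') (μ := μ) (x := x) (P := P) (L := L)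
    (fun a s' h hx => (hstep a s' h.1 h.2 hx).frame.mono fun s'' ⟨⟨a', h₁, h₂⟩, hf⟩ =>
      ⟨a', ⟨h₁, h.2.trans hf⟩, h₂⟩) ⟨h0, .refl P s⟩ hμ
  exact ⟨t, s', h₁, h₂, hQ a' s' h₃ h₄ h₅⟩

end Loop

/-- `for i = 0, …, (register b) - 1 do P`. -/
def Prog.forTo (i b : ℕ) (P : Prog) : Prog :=
  .seq (.assign i (.const 0))
    (.loop (.sub (.reg b) (.reg i)) (.seq P (.assign i (.add (.reg i) (.const 1)))))

theorem Halts.forTo {i b n : ℕ} (Inv : ℕ → State → Prop) (hb : s.reg b = n)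
    (hP : (P.keepsReg i && P.keepsReg b && (i != b)) = true) (hn : n ≤ L)
    (h0 : Inv 0 (s.setReg i 0))
    (hstep : ∀ j < n, ∀ s', Inv j s' → s'.reg i = j → Frame (.forTo i b P) s s' →
      Halts L P s' fun s'' => Inv (j + 1) (s''.setReg i (j + 1)))
    (hQ : ∀ s', Inv n s' → Q s') : Halts L (.forTo i b P) s Q := by
  obtain ⟨⟨hPi, hPb⟩, hib⟩ : (P.keepsReg i = true ∧ P.keepsReg b = true) ∧ i ≠ b := by
    simpa using hP
  have hb0 : (s.setReg i 0).reg b = n := by simp [hb, hib.symm]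
  have hfb {s'} (hf : Frame (.seq P (.assign i (.add (.reg i) (.const 1)))) (s.setReg i 0) s') :
      s'.reg b = n := (hf.reg b (by simp [Prog.keepsReg, hPb, hib])).trans hb0
  refine .exec_seq rfl (.loop (fun j s' => Inv j s' ∧ s'.reg i = j ∧ j ≤ n) (fun j _ => n - j)
    ?_ (a := 0) ⟨h0, by simp, n.zero_le⟩ (by omega) ?_)
  · rintro j s' ⟨hs', hj, -⟩ hf hx
    have hjn : j < n := by simp [hfb hf, hj] at hx; omega
    have hf' : Frame (.forTo i b P) s s' :=
      ⟨fun r hr => by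
        have ⟨hri, hrP, _⟩ : i ≠ r ∧ P.keepsReg r = true ∧ i ≠ r := by
          simpa [Prog.forTo, Prog.keepsReg] using hr
        rw [hf.reg r (by simp [Prog.keepsReg, hri, hrP])]
        simp [hri.symm],
      fun a ha => hf.arr a (by simpa [Prog.forTo, Prog.keepsArr] using ha)⟩
    refine (hstep j hjn s' hs' hj hf').frame.seq fun s'' ⟨h, hf''⟩ =>
      .exec rfl ⟨j + 1, ⟨?_, ?_, hjn⟩, by omega⟩
    · simpa [hf''.reg i hPi, hj] using h
    · simp [hf''.reg i hPi, hj]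
  · rintro j s' ⟨hs', hj, hjn⟩ hf hx
    simp [hfb hf, hj] at hx
    exact hQ s' (le_antisymm hjn (by omega) ▸ hs')

/-! ### Local search -/

section Search

variable {α : Type*} {Rep : α → State → Prop} {μ : α → ℕ} {fl : ℕ}

/-- The outcome of trying an improvement step on the object `a`: either `a` has been replaced by an
object of smaller measure and the flag `fl` has been raised, or `a` and the flag are as before and
`F` tells why. -/
def Progress (Rep : α → State → Prop) (μ : α → ℕ) (fl : ℕ) (s : State) (a : α) (F : Prop)
    (s' : State) : Prop :=
  (∃ a', Rep a' s' ∧ μ a' < μ a ∧ s'.reg fl = 1) ∨ (Rep a s' ∧ s'.reg fl = s.reg fl ∧ F)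

/-- Repeat `P` until it no longer raises the flag `fl`. -/
def Prog.search (fl : ℕ) (P : Prog) : Prog :=
  .seq (.assign fl (.const 1)) (.loop (.reg fl) (.seq (.assign fl (.const 0)) P))

theorem Halts.search {F : α → Prop} (hfl : ∀ a s c, Rep a s → Rep a (s.setReg fl c))
    (hP : ∀ a s, Rep a s → Halts L P s (Progress Rep μ fl s a (F a)))
    {a : α} (h0 : Rep a s) (hL : μ a < L) (hQ : ∀ a s', Rep a s' → F a → Q s') :
    Halts L (.search fl P) s Q := by
  refine .exec_seq rfl (.loop
    (fun a s => Rep a s ∧ s.reg fl ≤ 1 ∧ (s.reg fl = 0 → F a)) (fun a s => μ a + s.reg fl)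
    ?_ (a := a) ⟨hfl _ _ _ h0, by simp, by simp⟩ (by simpa using hL)
    fun a s' h _ hx => hQ a s' h.1 (h.2.2 hx))
  rintro a s ⟨ha, h1, -⟩ - hx
  have hs : s.reg fl = 1 := by simp at hx; omega
  refine .exec_seq rfl ((hP a _ (hfl a s 0 ha)).mono fun s' hs' => ?_)
  rcases hs' with ⟨a', ha', hμ, hs'⟩ | ⟨ha', hs', hF⟩
  · exact ⟨a', ⟨ha', by omega, by omega⟩, by omega⟩
  · have hs' : s'.reg fl = 0 := by simpa using hs'
    exact ⟨a, ⟨ha', by omega, fun _ => hF⟩, by omega⟩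

theorem Halts.scan {i b n : ℕ} {F : α → ℕ → Prop} (hi : ∀ a s c, Rep a s → Rep a (s.setReg i c))
    (hP : (P.keepsReg i && P.keepsReg b && (i != b)) = true) (hfl : fl ≠ i) (hn : n ≤ L)
    (hstep : ∀ j < n, ∀ a s, Rep a s → s.reg i = j →
      Halts L P s (Progress Rep μ fl s a (F a j)))
    {a : α} (h0 : Rep a s) (hb : s.reg b = n) :
    Halts L (.forTo i b P) s (Progress Rep μ fl s a (∀ j < n, F a j)) := by
  refine Halts.forTo (fun j s' => Progress Rep μ fl s a (∀ j' < j, F a j') s') hb hP hn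
    (.inr ⟨hi _ _ _ h0, by simp [hfl], by simp⟩) ?_ fun _ h => h
  rintro j hj s₁ (⟨a', ha', hμ, h1⟩ | ⟨ha, h1, hF⟩) hij -
  · refine (hstep j hj a' s₁ ha' hij).mono fun s₂ h => .inl ?_
    rcases h with ⟨a'', ha'', hμ', h2⟩ | ⟨ha', h2, -⟩
    · exact ⟨a'', hi _ _ _ ha'', hμ'.trans hμ, by simp [hfl, h2]⟩
    · exact ⟨a', hi _ _ _ ha', hμ, by simp [hfl, h2, h1]⟩
  · refine (hstep j hj a s₁ ha hij).mono fun s₂ h => ?_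
    rcases h with ⟨a'', ha'', hμ, h2⟩ | ⟨ha, h2, hFj⟩
    · exact .inl ⟨a'', hi _ _ _ ha'', hμ, by simp [hfl, h2]⟩
    · exact .inr ⟨hi _ _ _ ha, by simp [hfl, h2, h1],
        Nat.forall_lt_succ_right.2 ⟨hF, hFj⟩⟩

theorem Halts.search₂ {i j b c n m : ℕ} {F : α → ℕ → ℕ → Prop}
    (hreg : ∀ r ∈ [fl, i, j], ∀ a s x, Rep a s → Rep a (s.setReg r x))
    (hb : ∀ a s, Rep a s → s.reg b = n) (hc : ∀ a s, Rep a s → s.reg c = m)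
    (hP : ∀ r ∈ [i, j, b, c], P.keepsReg r = true)
    (hnodup : [fl, i, j].Nodup) (hdisj : ∀ r ∈ [b, c], r ∉ [i, j]) (hn : n ≤ L) (hm : m ≤ L)
    (hstep : ∀ u < n, ∀ v < m, ∀ a s, Rep a s → s.reg i = u → s.reg j = v →
      Halts L P s (Progress Rep μ fl s a (F a u v)))
    {a : α} (h0 : Rep a s) (hL : μ a < L)
    (hQ : ∀ a s', Rep a s' → (∀ u < n, ∀ v < m, F a u v) → Q s') :
    Halts L (.search fl (.forTo i b (.forTo j c P))) s Q := by
  have hRj := hreg j (by simp)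
  obtain ⟨hPi, hPj, hPb, hPc⟩ := by simpa using hP
  obtain ⟨⟨hfi, hfj⟩, hij⟩ := by simpa using hnodup
  obtain ⟨⟨hbi, hbj⟩, -, hcj⟩ := by simpa using hdisj
  refine Halts.search (F := fun a => ∀ u < n, ∀ v < m, F a u v)
    (hreg fl (by simp)) (fun a s ha => ?_) h0 hL hQ
  refine Halts.scan (F := fun a u => ∀ v < m, F a u v) (hreg i (by simp))
    (by simp [Prog.keepsReg, Prog.forTo, hPi, hPb, Ne.symm hij, Ne.symm hbj, Ne.symm hbi])
    hfi hn ?_ ha (hb _ _ ha)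
  intro u hu a s ha hs
  refine (Halts.scan (Rep := fun a s => Rep a s ∧ s.reg i = u) (F := fun a v => F a u v) (μ := μ)
    (fun a s x h => ⟨hRj _ _ _ h.1, by simp [hij, h.2]⟩) (by simp [hPj, hPc, Ne.symm hcj])
    hfj hm ?_ ⟨ha, hs⟩ (hc _ _ ha)).mono fun s' h => ?_
  · rintro v hv a s ⟨ha, hs⟩ hs'
    refine (hstep u hu v hv a s ha hs hs').frame.mono fun s' ⟨h, hf⟩ => ?_
    have hi := (hf.reg i hPi).trans hs
    exact h.imp (fun ⟨a', h, h'⟩ => ⟨a', ⟨h, hi⟩, h'⟩) fun ⟨h, h'⟩ => ⟨⟨h, hi⟩, h'⟩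
  · exact h.imp (fun ⟨a', h, h'⟩ => ⟨a', h.1, h'⟩) fun ⟨h, h'⟩ => ⟨h.1, h'⟩

end Search

/-- An expression that is zero if and only if the values of `x` and `y` are equal. -/
def Expr.ne (x y : Expr) : Expr := .add (.sub x y) (.sub y x)

@[simp]
theorem Expr.eval_ne {x y : Expr} {s : State} : (Expr.ne x y).eval s = 0 ↔ x.eval s = y.eval s := by
  simp only [Expr.ne, Expr.eval]; omega

end Ram

namespace KTrail

open Finset Ram

/-! ### Orientations -/

/-- A sequence of directed edges: edge `e` goes from `src e` to `dst e`. Only the first `m` edges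
count, for a number `m` that is passed separately. -/
structure Arcs (V : Type*) where
  /-- the tails of the edges -/
  src : ℕ → V
  /-- the heads of the edges -/
  dst : ℕ → V

namespace Arcs

section General

variable {V W : Type*} (D : Arcs V) (m : ℕ)

/-- Reachability by directed paths. -/
def Reach : V → V → Prop :=
  Relation.ReflTransGen fun x y => ∃ e < m, D.src e = x ∧ D.dst e = y

/-- Connectedness of the underlying undirected multigraph. -/
def Connected : Prop :=
  ∀ S : Set V, S.Nonempty → (∀ e < m, D.src e ∈ S ↔ D.dst e ∈ S) → S = Set.univ

/-- The same edges, up to orientation. -/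
def Same (D' : Arcs V) : Prop := ∀ e < m, s(D.src e, D.dst e) = s(D'.src e, D'.dst e)

/-- The image under a map of the vertices. -/
def map (φ : V → W) : Arcs W := ⟨φ ∘ D.src, φ ∘ D.dst⟩

variable {D m}

theorem Same.refl : D.Same m D := fun _ _ => rfl

theorem Same.symm {D' : Arcs V} (h : D.Same m D') : D'.Same m D := fun e he => (h e he).symm

theorem Same.trans {D' D'' : Arcs V} (h : D.Same m D') (h' : D'.Same m D'') : D.Same m D'' :=
  fun e he => (h e he).trans (h' e he)

theorem Same.eq_or_eq {D' : Arcs V} (h : D.Same m D') {e : ℕ} (he : e < m) :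
    (D.src e = D'.src e ∧ D.dst e = D'.dst e) ∨ (D.src e = D'.dst e ∧ D.dst e = D'.src e) :=
  Sym2.eq_iff.1 (h e he)

theorem Connected.map {φ : V → W} (h : D.Connected m) (hφ : φ.Surjective) :
    (D.map φ).Connected m := fun S hS hS' =>
  Set.preimage_injective.2 hφ (h (φ ⁻¹' S) (hS.preimage hφ) hS')

variable (D m) [DecidableEq V]

/-- The number of edges with head `v`. -/
def indeg (v : V) : ℕ := #{e ∈ range m | D.dst e = v}

/-- The degree of `v`, loops being counted twice. -/
def deg (v : V) : ℕ := #{e ∈ range m | D.src e = v} + D.indeg m v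

/-- The number of edges entering `X`. -/
def enter (X : Finset V) : ℕ := #{e ∈ range m | D.src e ∉ X ∧ D.dst e ∈ X}

/-- The number of edges inside `X`. -/
def inner (X : Finset V) : ℕ := #{e ∈ range m | D.src e ∈ X ∧ D.dst e ∈ X}

variable {D m}

theorem Same.inner_eq {D' : Arcs V} (h : D.Same m D') (X : Finset V) :
    D.inner m X = D'.inner m X := by
  refine congrArg card (filter_congr fun e he => ?_)
  rcases h.eq_or_eq (mem_range.1 he) with ⟨h₁, h₂⟩ | ⟨h₁, h₂⟩ <;> rw [h₁, h₂]
  exact and_comm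

theorem Same.deg_eq {D' : Arcs V} (h : D.Same m D') (v : V) : D.deg m v = D'.deg m v := by
  simp only [deg, indeg, card_filter, ← sum_add_distrib]
  refine sum_congr rfl fun e he => ?_
  rcases h.eq_or_eq (mem_range.1 he) with ⟨h₁, h₂⟩ | ⟨h₁, h₂⟩ <;> rw [h₁, h₂]
  exact add_comm _ _

theorem sum_indeg (X : Finset V) : ∑ v ∈ X, D.indeg m v = D.enter m X + D.inner m X := by
  have hcard : ∑ v ∈ X, D.indeg m v = #{e ∈ range m | D.dst e ∈ X} := by
    simp only [indeg, card_filter]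
    rw [sum_comm]
    simp
  rw [hcard, ← card_filter_add_card_filter_not (s := {e ∈ range m | D.dst e ∈ X})
    (fun e => D.src e ∈ X), filter_filter, filter_filter, add_comm]
  simp only [enter, inner, and_comm]

theorem enter_union_add_enter_inter (X Y : Finset V) :
    D.enter m (X ∪ Y) + D.enter m (X ∩ Y) ≤ D.enter m X + D.enter m Y := by
  simp only [enter, card_filter, ← sum_add_distrib]
  refine sum_le_sum fun e _ => ?_
  by_cases h₁ : D.src e ∈ X <;> by_cases h₂ : D.src e ∈ Y <;> by_cases h₃ : D.dst e ∈ X <;>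
    by_cases h₄ : D.dst e ∈ Y <;> simp [h₁, h₂, h₃, h₄]

theorem Reach.enter_pos {X : Finset V} {a b : V} (h : D.Reach m a b) (ha : a ∉ X)
    (hb : b ∈ X) : 0 < D.enter m X := by
  induction h with
  | refl => exact absurd hb ha
  | @tail c d _ hcd ih =>
    obtain ⟨e, he, rfl, rfl⟩ := hcd
    by_cases hc : D.src e ∈ X
    · exact ih hc
    · exact card_pos.2 ⟨e, by simp [he, hc, hb]⟩

theorem deg_map [DecidableEq W] {φ : V → W} {T : Finset V}
    (hT : ∀ e < m, D.src e ∈ T ∧ D.dst e ∈ T) (u : W) :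
    (D.map φ).deg m u = ∑ w ∈ T with φ w = u, D.deg m w := by
  have hsum (z : ℕ → V) (hz : ∀ e < m, z e ∈ T) : #{e ∈ range m | φ (z e) = u} =
      ∑ w ∈ T with φ w = u, #{e ∈ range m | z e = w} := by
    simp only [card_filter]
    rw [sum_comm]
    exact sum_congr rfl fun e he => by simp [hz e (mem_range.1 he)]
  simp only [deg, indeg, sum_add_distrib]
  exact congrArg₂ _ (hsum _ fun e he => (hT e he).1) (hsum _ fun e he => (hT e he).2)

theorem deg_map_le_mul_card [Fintype V] [DecidableEq W] {φ : V → W} {k : ℕ}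
    (hdeg : ∀ w, D.deg m w ≤ k) (u : W) : (D.map φ).deg m u ≤ k * #{w | φ w = u} := by
  rw [deg_map (T := univ) (fun _ _ => by simp), mul_comm]
  exact sum_le_card_nsmul _ _ _ fun w _ => hdeg w

theorem Connected.card_le [Fintype V] [Nonempty V] (h : D.Connected m) :
    Fintype.card V ≤ #{e ∈ range m | D.src e ≠ D.dst e} + 1 := by
  let G : SimpleGraph V := SimpleGraph.fromRel fun a b => ∃ e < m, D.src e = a ∧ D.dst e = b
  have hreach {e : ℕ} (he : e < m) : G.Reachable (D.src e) (D.dst e) := by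
    by_cases hne : D.src e = D.dst e
    · rw [hne]
    · exact SimpleGraph.Adj.reachable (SimpleGraph.fromRel_adj _ _ _ |>.2
        ⟨hne, .inl ⟨e, he, rfl, rfl⟩⟩)
  have hG : G.Connected := ⟨fun a b => Set.eq_univ_iff_forall.1 (h {b | G.Reachable a b}
    ⟨a, .refl _⟩ fun e he => ⟨fun h => h.trans (hreach he), fun h => h.trans (hreach he).symm⟩) b⟩
  have hsub : G.edgeSet ⊆ ({e ∈ range m | D.src e ≠ D.dst e}.image fun e => s(D.src e, D.dst e) :
      Finset (Sym2 V)) := by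
    intro z
    induction z with
    | h a b =>
      rw [SimpleGraph.mem_edgeSet, SimpleGraph.fromRel_adj]
      rintro ⟨hab, ⟨e, he, rfl, rfl⟩ | ⟨e, he, rfl, rfl⟩⟩
      · exact mem_coe.2 (mem_image.2 ⟨e, by simp [he, hab], rfl⟩)
      · exact mem_coe.2 (mem_image.2 ⟨e, by simp [he, hab.symm], Sym2.eq_swap⟩)
  calc Fintype.card V = Nat.card V := Nat.card_eq_fintype_card.symm
    _ ≤ G.edgeSet.ncard + 1 := hG.card_vert_le_card_edgeSet_add_one
    _ ≤ #({e ∈ range m | D.src e ≠ D.dst e}.image fun e => s(D.src e, D.dst e)) + 1 := by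
      rw [← Set.ncard_coe_finset]
      exact Nat.add_le_add_right (Set.ncard_le_ncard hsub (finite_toSet _)) 1
    _ ≤ _ := Nat.add_le_add_right card_image_le 1

end General

/-- Contracting the preimages of disjoint sets of vertices. -/
theorem Connected.card_add_sum_inner_map_le {V W : Type*} [Fintype V] [Nonempty V] [DecidableEq W]
    {D : Arcs V} {m : ℕ} (h : D.Connected m) {φ : V → W} {𝓕 : Finset (Finset W)}
    (hdisj : (𝓕 : Set (Finset W)).PairwiseDisjoint id) (hmem : ∀ X ∈ 𝓕, ∃ w, φ w ∈ X) :
    #{w | φ w ∉ 𝓕.biUnion id} + #𝓕 + ∑ X ∈ 𝓕, (D.map φ).inner m X ≤ m + 1 := by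
  classical
  choose! cls hcls using fun u (hu : u ∈ 𝓕.biUnion id) => mem_biUnion.1 hu
  let ψ : V → {w // φ w ∉ 𝓕.biUnion id} ⊕ 𝓕 := fun w =>
    if hw : φ w ∈ 𝓕.biUnion id then .inr ⟨cls (φ w), (hcls _ hw).1⟩ else .inl ⟨w, hw⟩
  have hψX {X} (hX : X ∈ 𝓕) {w} (hw : φ w ∈ X) : ψ w = .inr ⟨X, hX⟩ := by
    have hwZ : φ w ∈ 𝓕.biUnion id := mem_biUnion.2 ⟨X, hX, hw⟩
    exact (dif_pos hwZ).trans (congrArg Sum.inr (Subtype.ext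
      (hdisj.elim_finset (hcls _ hwZ).1 hX _ (hcls _ hwZ).2 hw)))
  have hψ : ψ.Surjective := by
    rintro (⟨w, hw⟩ | ⟨X, hX⟩)
    · exact ⟨w, by simp only [ψ, dif_neg hw]⟩
    · obtain ⟨w, hw⟩ := hmem X hX
      exact ⟨w, hψX hX hw⟩
  have : Nonempty ({w // φ w ∉ 𝓕.biUnion id} ⊕ 𝓕) := Nonempty.map ψ inferInstance
  have hcard := (h.map hψ).card_le
  rw [Fintype.card_sum, Fintype.card_coe, Fintype.card_subtype] at hcard
  have hinner : ∑ X ∈ 𝓕, (D.map φ).inner m X ≤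
      #{e ∈ range m | ¬ (D.map ψ).src e ≠ (D.map ψ).dst e} := by
    simp only [inner]
    rw [← card_biUnion]
    · refine card_le_card fun e he => ?_
      obtain ⟨X, hX, he⟩ := mem_biUnion.1 he
      obtain ⟨hem, hs, hd⟩ := mem_filter.1 he
      exact mem_filter.2 ⟨hem, not_not.2 ((hψX hX hs).trans (hψX hX hd).symm)⟩
    · intro X hX Y hY hne
      refine Finset.disjoint_left.2 fun e he he' => hne ?_
      exact hdisj.elim_finset hX hY _ (mem_filter.1 he).2.1 (mem_filter.1 he').2.1
  have := card_filter_add_card_filter_not (s := range m)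
    (fun e => (D.map ψ).src e ≠ (D.map ψ).dst e)
  rw [card_range] at this
  omega

/-! ### Rooted orientations and tight sets -/

variable (D : Arcs ℕ) (m n : ℕ)

/-- The number of copies of `v` in a tree that is oriented as `D`, away from a root over `0`: one
for every edge entering a copy, and the root. -/
def copies (v : ℕ) : ℕ := D.indeg m v + if v = 0 then 1 else 0

/-- All vertices are reachable from the vertex `0`. -/
def Rooted : Prop := ∀ x < n, D.Reach m 0 x

/-- `X` is a nonempty set of vertices other than `v`, and as few edges enter it as is possible if
all vertices are to be reachable from `0`. -/
structure TightAvoiding (v : ℕ) (X : Finset ℕ) : Prop where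
  subset : X ⊆ range n
  nonempty : X.Nonempty
  notMem : v ∉ X
  enter_eq : D.enter m X = if 0 ∈ X then 0 else 1

open Classical in
/-- The maximal tight sets avoiding `v`. -/
noncomputable def maxTight (v : ℕ) : Finset (Finset ℕ) :=
  {X ∈ (range n).powerset | Maximal (D.TightAvoiding m n v) X}

variable {D m n} {v : ℕ}

theorem mem_maxTight {X : Finset ℕ} :
    X ∈ D.maxTight m n v ↔ Maximal (D.TightAvoiding m n v) X := by
  simpa [maxTight] using fun h : Maximal _ X => h.1.subset

theorem TightAvoiding.subset_biUnion_maxTight {X : Finset ℕ} (hX : D.TightAvoiding m n v X) :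
    X ⊆ (D.maxTight m n v).biUnion id := by
  have hfin : {Y | D.TightAvoiding m n v Y}.Finite :=
    (range n).powerset.finite_toSet.subset fun Y hY => mem_coe.2 (mem_powerset.2 hY.subset)
  obtain ⟨Y, hXY, hY⟩ := hfin.exists_le_maximal hX
  exact fun u hu => mem_biUnion.2 ⟨Y, mem_maxTight.2 hY, hXY hu⟩

theorem Rooted.le_enter (h : D.Rooted m n) {X : Finset ℕ} (hX : X ⊆ range n)
    (hne : X.Nonempty) : (if 0 ∈ X then 0 else 1) ≤ D.enter m X := by
  split_ifs with h0
  · exact Nat.zero_le _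
  · obtain ⟨x, hx⟩ := hne
    exact (h x (mem_range.1 (hX hx))).enter_pos h0 hx

/-- Submodularity of `enter` leaves no slack for the union. -/
theorem Rooted.tightAvoiding_union (h : D.Rooted m n) {X Y : Finset ℕ}
    (hX : D.TightAvoiding m n v X) (hY : D.TightAvoiding m n v Y) (hXY : (X ∩ Y).Nonempty) :
    D.TightAvoiding m n v (X ∪ Y) where
  subset := union_subset hX.subset hY.subset
  nonempty := hX.nonempty.mono subset_union_left
  notMem := by simp [hX.notMem, hY.notMem]
  enter_eq := by
    have h₁ := h.le_enter (union_subset hX.subset hY.subset) (hX.nonempty.mono subset_union_left)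
    have h₂ := h.le_enter (inter_subset_left.trans hX.subset) hXY
    have h₃ := enter_union_add_enter_inter (D := D) (m := m) X Y
    rw [hX.enter_eq, hY.enter_eq] at h₃
    simp only [mem_union, mem_inter] at *
    by_cases h₄ : 0 ∈ X <;> by_cases h₅ : 0 ∈ Y <;> simp [h₄, h₅] at * <;> omega

theorem Rooted.pairwiseDisjoint_maxTight (h : D.Rooted m n) :
    (D.maxTight m n v : Set (Finset ℕ)).PairwiseDisjoint id := by
  intro X hX Y hY hne
  replace hX := mem_maxTight.1 (mem_coe.1 hX)
  replace hY := mem_maxTight.1 (mem_coe.1 hY)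
  by_contra hXY
  have hU := h.tightAvoiding_union hX.1 hY.1
    (nonempty_iff_ne_empty.2 fun h => hXY (disjoint_iff_inter_eq_empty.2 h))
  exact hne ((hX.eq_of_le hU subset_union_left).trans (hY.eq_of_le hU subset_union_right).symm)

theorem sum_copies_range (hval : ∀ e < m, D.src e < n ∧ D.dst e < n) (hn : 0 < n) :
    ∑ u ∈ range n, D.copies m u = m + 1 := by
  have hm : D.enter m (range n) + D.inner m (range n) = m := by
    rw [enter, inner, filter_false_of_mem, filter_true_of_mem] <;> simp +contextual [hval]
  simp [copies, sum_add_distrib, sum_indeg, hm, hn]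

theorem TightAvoiding.sum_copies {X : Finset ℕ} (hX : D.TightAvoiding m n v X) :
    ∑ u ∈ X, D.copies m u = D.inner m X + 1 := by
  simp only [copies, sum_add_distrib, sum_indeg, hX.enter_eq, sum_ite_eq']
  split_ifs <;> omega

theorem Rooted.sum_copies_sdiff_maxTight (h : D.Rooted m n)
    (hval : ∀ e < m, D.src e < n ∧ D.dst e < n) (hn : 0 < n) :
    ∑ u ∈ range n \ (D.maxTight m n v).biUnion id, D.copies m u +
      ∑ X ∈ D.maxTight m n v, D.inner m X + #(D.maxTight m n v) = m + 1 := by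
  have hsub : (D.maxTight m n v).biUnion id ⊆ range n :=
    biUnion_subset.2 fun X hX => (mem_maxTight.1 hX).1.subset
  have htight : ∑ X ∈ D.maxTight m n v, ∑ u ∈ id X, D.copies m u =
      ∑ X ∈ D.maxTight m n v, (D.inner m X + 1) :=
    sum_congr rfl fun X hX => (mem_maxTight.1 hX).1.sum_copies
  rw [← sum_copies_range hval hn, ← sum_sdiff hsub, sum_biUnion h.pairwiseDisjoint_maxTight,
    htight, sum_add_distrib, sum_const, smul_eq_mul, mul_one, add_assoc]

theorem sum_copies_sdiff_maxTight_lt {k : ℕ} {c : ℕ → ℕ} (hv : v < n)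
    (hdef : k * D.copies m v < D.deg m v)
    (hstuck : ∀ u < n, D.deg m u + k ≤ k * D.copies m u →
      ∃ X, D.TightAvoiding m n v X ∧ u ∈ X) (hc : ∀ u, D.deg m u ≤ k * c u) :
    ∑ u ∈ range n \ (D.maxTight m n v).biUnion id, D.copies m u <
      ∑ u ∈ range n \ (D.maxTight m n v).biUnion id, c u := by
  have hvZ : v ∉ (D.maxTight m n v).biUnion id := fun h => by
    obtain ⟨X, hX, hvX⟩ := mem_biUnion.1 h
    exact (mem_maxTight.1 hX).1.notMem hvX
  refine sum_lt_sum (fun u hu => ?_) ⟨v, mem_sdiff.2 ⟨mem_range.2 hv, hvZ⟩,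
    Nat.lt_of_mul_lt_mul_left (hdef.trans_le (hc v))⟩
  obtain ⟨hun, huZ⟩ := mem_sdiff.1 hu
  have hns : k * D.copies m u < D.deg m u + k := by
    by_contra! hle
    obtain ⟨X, hX, huX⟩ := hstuck u (mem_range.1 hun) hle
    exact huZ (hX.subset_biUnion_maxTight huX)
  refine Nat.lt_succ_iff.1 (Nat.lt_of_mul_lt_mul_left (a := k) ?_)
  rw [Nat.mul_succ]
  exact hns.trans_le (Nat.add_le_add_right (hc u) k)

/-- Contracting the maximal tight sets avoiding `v` leaves, over the other vertices, at least as
many copies as the orientation `D` provides, one more over `v`, and too few edges to connect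
them. -/
theorem Rooted.not_connected_of_stuck {W : Type*} [Finite W] [DecidableEq W] {B : Arcs W}
    {φ : W → ℕ} {k : ℕ} (hroot : D.Rooted m n) (hval : ∀ e < m, D.src e < n ∧ D.dst e < n)
    (hv : v < n) (hdef : k * D.copies m v < D.deg m v)
    (hstuck : ∀ u < n, D.deg m u + k ≤ k * D.copies m u →
      ∃ X, D.TightAvoiding m n v X ∧ u ∈ X)
    (hφ : Set.range φ = Set.Iio n) (hsame : (B.map φ).Same m D) (hdeg : ∀ w, B.deg m w ≤ k) :
    ¬ B.Connected m := by
  intro hconn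
  have := Fintype.ofFinite W
  set Z := (D.maxTight m n v).biUnion id with hZ
  have hcopies (u : ℕ) : D.deg m u ≤ k * #{w | φ w = u} :=
    (hsame.deg_eq u).symm.trans_le (deg_map_le_mul_card hdeg u)
  have hlt := sum_copies_sdiff_maxTight_lt hv hdef hstuck hcopies
  have hfiber : #{w | φ w ∉ Z} = ∑ u ∈ range n \ Z, #{w | φ w = u} := by
    have hφn (w : W) : φ w < n := Set.mem_Iio.1 (hφ ▸ Set.mem_range_self w)
    simp only [card_filter]
    rw [sum_comm]
    exact sum_congr rfl fun w _ => by simp [hφn w]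
  have hmem (X) (hX : X ∈ D.maxTight m n v) : ∃ w, φ w ∈ X := by
    obtain ⟨u, hu⟩ := (mem_maxTight.1 hX).1.nonempty
    obtain ⟨w, rfl⟩ : u ∈ Set.range φ :=
      hφ ▸ mem_range.1 ((mem_maxTight.1 hX).1.subset hu)
    exact ⟨w, hu⟩
  obtain ⟨w₀, -⟩ : v ∈ Set.range φ := hφ ▸ hv
  have : Nonempty W := ⟨w₀⟩
  have hcontract := hconn.card_add_sum_inner_map_le hroot.pairwiseDisjoint_maxTight hmem
  simp only [hsame.inner_eq, ← hZ] at hcontract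
  have hcount := hroot.sum_copies_sdiff_maxTight (v := v) hval (Nat.zero_lt_of_lt hv)
  rw [← hZ] at hcount hlt
  omega

end Arcs

/-! ### Graphs and lists of edges -/

theorem Arcs.Same.lt {D D' : Arcs ℕ} {m n : ℕ} (h : D.Same m D')
    (hval : ∀ e < m, D'.src e < n ∧ D'.dst e < n) : ∀ e < m, D.src e < n ∧ D.dst e < n := by
  intro e he
  rcases h.eq_or_eq he with ⟨h₁, h₂⟩ | ⟨h₁, h₂⟩ <;> rw [h₁, h₂]
  · exact hval e he
  · exact (hval e he).symm

theorem IsConnected.mem_of_closed {α β : Type*} {G : Graph α β} (h : IsConnected G)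
    {S : Set α} (hne : ∃ a ∈ G.vertexSet, a ∈ S)
    (hS : ∀ e u v, G.IsLink e u v → u ∈ S → v ∈ S) {b : α} (hb : b ∈ G.vertexSet) : b ∈ S := by
  obtain ⟨a, ha, haS⟩ := hne
  obtain ⟨p⟩ := h.preconnected ⟨a, ha⟩ ⟨b, hb⟩
  suffices ∀ u v : G.vertexSet, G.toSimpleGraph.Walk u v → u.1 ∈ S → v.1 ∈ S from this _ _ p haS
  intro u v p
  induction p with
  | nil => exact id
  | cons hadj _ ih =>
    obtain ⟨-, e, he⟩ := hadj
    exact fun hu => ih (hS e _ _ he hu)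

theorem reachable_of_isLink {α β : Type*} {G : Graph α β} {e : β} {x y : G.vertexSet}
    (h : G.IsLink e x y) : G.toSimpleGraph.Reachable x y := by
  by_cases hxy : x = y
  · rw [hxy]
  · exact SimpleGraph.Adj.reachable ⟨hxy, e, h⟩

theorem degree_eq_deg {α β V : Type*} [DecidableEq V] {G : Graph α β} {B : Arcs V} {m : ℕ}
    (σ : Fin m ≃ G.edgeSet) {w : α} {v : V}
    (hinc : ∀ e, G.Inc (σ e) w ↔ B.src e = v ∨ B.dst e = v)
    (hloop : ∀ e, G.IsLoopAt (σ e) w ↔ B.src e = v ∧ B.dst e = v) :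
    degree G w = B.deg m v := by
  have hcount (p : ℕ → Prop) [DecidablePred p] (q : β → Prop) (hq : ∀ f, q f → f ∈ G.edgeSet)
      (hpq : ∀ e, q (σ e) ↔ p e) : {f | q f}.ncard = #{e ∈ range m | p e} := by
    have himage : {f | q f} = (Subtype.val ∘ σ) '' {e : Fin m | p e} := by
      ext f
      refine ⟨fun hf => ⟨σ.symm ⟨f, hq f hf⟩, ?_, by simp⟩, ?_⟩
      · exact (hpq _).1 (by simpa using hf)
      · rintro ⟨e, he, rfl⟩
        exact (hpq e).2 he
    rw [himage, Set.ncard_image_of_injective _ (Subtype.val_injective.comp σ.injective),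
      card_filter, ← Fin.sum_univ_eq_sum_range (fun e => if p e then 1 else 0), ← card_filter,
      ← Set.ncard_coe_finset]
    simp
  rw [degree, hcount (fun e => B.src e = v ∨ B.dst e = v) _ (fun _ h => h.edge_mem) hinc,
    hcount (fun e => B.src e = v ∧ B.dst e = v) _ (fun _ h => h.edge_mem) hloop,
    filter_or, filter_and, card_union_add_card_inter]
  rfl

section Enumeration

variable {α β : Type*} {G : Graph α β} {B : Arcs G.vertexSet} {m : ℕ} {σ : Fin m ≃ G.edgeSet}

theorem degree_eq_deg_of_isLink [DecidableEq G.vertexSet]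
    (h : ∀ e, G.IsLink (σ e) (B.src e) (B.dst e)) (w : G.vertexSet) :
    degree G w = B.deg m w := by
  refine degree_eq_deg σ (fun e => ⟨fun ⟨y, hy⟩ => ?_, ?_⟩) fun e => ⟨fun hl => ?_, ?_⟩
  · exact (hy.eq_and_eq_or_eq_and_eq (h e)).imp (fun h => Subtype.ext h.1.symm)
      fun h => Subtype.ext h.1.symm
  · rintro (rfl | rfl)
    exacts [⟨_, h e⟩, ⟨_, (h e).symm⟩]
  · rcases Graph.IsLink.eq_and_eq_or_eq_and_eq hl (h e) with ⟨h₁, h₂⟩ | ⟨h₁, h₂⟩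
    exacts [⟨Subtype.ext h₁.symm, Subtype.ext h₂.symm⟩, ⟨Subtype.ext h₂.symm, Subtype.ext h₁.symm⟩]
  · rintro ⟨h₁, h₂⟩
    have := h e
    rwa [h₁, h₂] at this

theorem IsConnected.connected_of_isLink (hG : IsConnected G)
    (h : ∀ e, G.IsLink (σ e) (B.src e) (B.dst e)) : B.Connected m := by
  rintro S ⟨a, ha⟩ hS
  refine Set.eq_univ_of_forall fun b => ?_
  suffices ∃ hb : b.1 ∈ G.vertexSet, ⟨b.1, hb⟩ ∈ S from this.2
  refine hG.mem_of_closed (S := {x | ∃ hx, ⟨x, hx⟩ ∈ S}) ⟨a, a.2, a.2, ha⟩ ?_ b.2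
  rintro f u v hf ⟨hu, huS⟩
  refine ⟨hf.right_mem, ?_⟩
  obtain ⟨e, he⟩ := σ.surjective ⟨f, hf.edge_mem⟩
  have hlink := h e
  rw [he] at hlink
  rcases hf.eq_and_eq_or_eq_and_eq hlink with ⟨rfl, rfl⟩ | ⟨rfl, rfl⟩
  · exact (hS e e.2).1 huS
  · exact (hS e e.2).2 huS

end Enumeration

namespace EdgeList

/-- The edges of a multigraph, oriented as they are listed. -/
def arcs (G : EdgeList) : Arcs ℕ where
  src e := if h : e < G.m then (G.ends ⟨e, h⟩).1 else 0
  dst e := if h : e < G.m then (G.ends ⟨e, h⟩).2 else 0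

variable {G H : EdgeList}

theorem arcs_lt {e : ℕ} (he : e < G.m) : G.arcs.src e < G.n ∧ G.arcs.dst e < G.n := by
  simp [arcs, he]

@[simp]
theorem arcs_src (e : Fin G.m) : G.arcs.src e = (G.ends e).1 := by simp [arcs]

@[simp]
theorem arcs_dst (e : Fin G.m) : G.arcs.dst e = (G.ends e).2 := by simp [arcs]

theorem isLink_toGraph {e : Fin G.m} {x y : Fin G.n} :
    G.toGraph.IsLink e x y ↔ s(G.arcs.src e, G.arcs.dst e) = s((x : ℕ), (y : ℕ)) := by
  change s((G.ends e).1, (G.ends e).2) = s(x, y) ↔ _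
  rw [Sym2.eq_iff, Sym2.eq_iff, arcs_src, arcs_dst]
  simp only [Fin.ext_iff]

theorem degree_toGraph (v : Fin G.n) : degree G.toGraph v = G.arcs.deg G.m v := by
  refine degree_eq_deg (Equiv.Set.univ _).symm (fun e => ⟨?_, ?_⟩) fun e => ?_
  · rintro ⟨y, hy⟩
    exact (Sym2.eq_iff.1 (isLink_toGraph.1 hy)).imp And.left And.right
  · rintro (h | h)
    · exact ⟨(G.ends e).2, isLink_toGraph.2 (Sym2.eq_iff.2 (.inl ⟨h, arcs_dst e⟩))⟩
    · exact ⟨(G.ends e).1, isLink_toGraph.2 (Sym2.eq_iff.2 (.inr ⟨arcs_src e, h⟩))⟩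
  · exact isLink_toGraph.trans (Sym2.eq_iff.trans (or_iff_left_of_imp fun h => h))

theorem mem_of_closed (h : IsConnected G.toGraph) {D : Arcs ℕ} (hD : D.Same G.m G.arcs)
    {S : Set ℕ} {a : ℕ} (ha : a < G.n) (haS : a ∈ S)
    (hS : ∀ e < G.m, D.src e ∈ S ↔ D.dst e ∈ S) {b : ℕ} (hb : b < G.n) : b ∈ S := by
  refine IsConnected.mem_of_closed h (S := {u : Fin G.n | u.1 ∈ S}) ⟨⟨a, ha⟩, trivial, haS⟩
    (fun e u v he hu => ?_) (b := ⟨b, hb⟩) trivial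
  have hiff := hS e e.2
  rcases Sym2.eq_iff.1 ((hD e e.2).trans (isLink_toGraph.1 he)) with ⟨h₁, h₂⟩ | ⟨h₁, h₂⟩ <;>
    rw [h₁, h₂] at hiff
  exacts [hiff.1 hu, hiff.2 hu]

/-- As a spanning tree needs all the edges, none of them is a loop or parallel to another one. -/
theorem isTree_of_isConnected (h : IsConnected G.toGraph) (hn : G.n = G.m + 1) :
    IsTree G.toGraph := by
  let f : Fin G.m → Sym2 G.toGraph.vertexSet := fun e =>
    s(⟨(G.ends e).1, trivial⟩, ⟨(G.ends e).2, trivial⟩)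
  have hf {e : Fin G.m} {x y : G.toGraph.vertexSet} (he : G.toGraph.IsLink e x y) :
      f e = s(x, y) := by
    rcases Sym2.eq_iff.1 (show s((G.ends e).1, (G.ends e).2) = s(x.1, y.1) from he) with h | h
    · exact Sym2.eq_iff.2 (.inl ⟨Subtype.ext h.1, Subtype.ext h.2⟩)
    · exact Sym2.eq_iff.2 (.inr ⟨Subtype.ext h.1, Subtype.ext h.2⟩)
  have hsub : G.toGraph.toSimpleGraph.edgeSet ⊆ Set.range f := by
    intro z
    induction z with
    | h x y => exact fun ⟨_, e, he⟩ => ⟨e, hf he⟩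
  have : Finite G.toGraph.vertexSet := inferInstanceAs (Finite (Set.univ : Set (Fin G.n)))
  have hV : Nat.card G.toGraph.vertexSet = G.m + 1 :=
    (Set.ncard_univ (Fin G.n)).trans (by simp [hn])
  have hcard : G.m ≤ G.toGraph.toSimpleGraph.edgeSet.ncard := by
    have := SimpleGraph.Connected.card_vert_le_card_edgeSet_add_one h
    rw [hV] at this
    exact Nat.le_of_succ_le_succ this
  have hrange : (Set.range f).ncard ≤ G.m := by
    exact (Finite.card_range_le f).trans_eq (Nat.card_fin _)
  have hedge : G.toGraph.toSimpleGraph.edgeSet = Set.range f :=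
    Set.eq_of_subset_of_ncard_le hsub (hrange.trans hcard)
  have hinj : f.Injective := by
    rw [← Set.injOn_univ]
    refine Set.injOn_of_ncard_image_eq ?_
    rw [Set.image_univ, ← hedge, Set.ncard_univ, Nat.card_fin]
    exact (hedge ▸ hrange).antisymm hcard
  refine ⟨{ not_isLoopAt := fun e x he => ?_, eq_of_isLink := fun e e' x y he he' => ?_ }, ?_⟩
  · have hmem : s((⟨x, trivial⟩ : G.toGraph.vertexSet), ⟨x, trivial⟩) ∈
        G.toGraph.toSimpleGraph.edgeSet := hedge ▸ ⟨e, hf he⟩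
    exact SimpleGraph.not_isDiag_of_mem_edgeSet _ hmem rfl
  · exact hinj ((hf (x := ⟨x, trivial⟩) (y := ⟨y, trivial⟩) he).trans (hf he').symm)
  · refine SimpleGraph.isTree_iff_connected_and_card.2 ⟨h, ?_⟩
    rw [hV, hedge]
    exact congrArg (· + 1) (hrange.antisymm (hedge ▸ hcard))

theorem isHomImageBy_toGraph (hm : H.m = G.m) {φ : Fin H.n → Fin G.n} (hφ : φ.Surjective)
    (hends : ∀ e : Fin H.m, s(φ (H.ends e).1, φ (H.ends e).2) =
      s((G.ends (e.cast hm)).1, (G.ends (e.cast hm)).2)) :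
    IsHomImageBy G.toGraph H.toGraph φ := by
  obtain ⟨n, m, ends⟩ := H
  obtain rfl : m = G.m := hm
  refine ⟨(Set.image_univ_of_surjective hφ), fun u _ v _ => congrArg Set.ncard ?_⟩
  ext e
  refine ⟨fun he => ⟨_, _, rfl, (hends e).trans he⟩, ?_⟩
  rintro ⟨x, y, he, hxy⟩
  exact (hends e).symm.trans ((congrArg (Sym2.map φ) he).trans hxy)

end EdgeList

/-! ### Graphs that are not `k`-trails -/

theorem IsHomImageBy.exists_equiv {G : EdgeList} {γ δ : Type*} {H : Graph γ δ}
    {φ : γ → Fin G.n} (h : IsHomImageBy G.toGraph H φ) (hE : H.edgeSet.Finite) :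
    ∃ (σ : Fin G.m ≃ H.edgeSet) (x y : Fin G.m → γ), ∀ e, H.IsLink (σ e) (x e) (y e) ∧
      s(φ (x e), φ (y e)) = s((G.ends e).1, (G.ends e).2) := by
  choose X Y hXY using fun f : H.edgeSet => H.exists_isLink_of_mem_edgeSet f.2
  have := hE.to_subtype
  have hiff (z : Sym2 (Fin G.n)) (f : H.edgeSet) :
      (∃ x y, H.IsLink f x y ∧ s(φ x, φ y) = z) ↔ s(φ (X f), φ (Y f)) = z := by
    refine ⟨fun ⟨x, y, hl, hs⟩ => ?_, fun h => ⟨_, _, hXY f, h⟩⟩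
    rcases (hXY f).eq_and_eq_or_eq_and_eq hl with ⟨h₁, h₂⟩ | ⟨h₁, h₂⟩ <;> rw [h₁, h₂]
    exacts [hs, Sym2.eq_swap.trans hs]
  have hfib (z : Sym2 (Fin G.n)) : Nonempty
      ({e : Fin G.m // s((G.ends e).1, (G.ends e).2) = z} ≃
        {f : H.edgeSet // s(φ (X f), φ (Y f)) = z}) := by
    refine Finite.card_eq.1 (Eq.trans ?_ (Nat.card_congr (Equiv.subtypeEquivRight (hiff z))))
    induction z with
    | h u v =>
      refine (h.ncard_eq u trivial v trivial).trans (Nat.card_congr ?_)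
      exact ⟨fun f => ⟨⟨f.1, f.2.choose_spec.choose_spec.1.edge_mem⟩, f.2⟩,
        fun f => ⟨f.1.1, f.2⟩, fun _ => rfl, fun _ => rfl⟩
  let σ : Fin G.m ≃ H.edgeSet := Equiv.ofFiberEquiv fun z => (hfib z).some
  exact ⟨σ, X ∘ σ, Y ∘ σ, fun e => ⟨hXY _, Equiv.ofFiberEquiv_map
    (f := fun e => s((G.ends e).1, (G.ends e).2)) (g := fun f => s(φ (X f), φ (Y f))) _ e⟩⟩

theorem IsHomImageBy.exists_arcs {G : EdgeList} {γ δ : Type*} {H : Graph γ δ}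
    {φ : γ → Fin G.n} (h : IsHomImageBy G.toGraph H φ) (hE : H.edgeSet.Finite)
    (hne : Nonempty H.vertexSet) :
    ∃ (σ : Fin G.m ≃ H.edgeSet) (B : Arcs H.vertexSet),
      (∀ e, H.IsLink (σ e) (B.src e) (B.dst e)) ∧
        (B.map fun w => (φ w : ℕ)).Same G.m G.arcs := by
  obtain ⟨σ, x, y, hσ⟩ := h.exists_equiv hE
  refine ⟨σ, ⟨fun e => if he : e < G.m then ⟨x ⟨e, he⟩, (hσ _).1.left_mem⟩ else hne.some,
    fun e => if he : e < G.m then ⟨y ⟨e, he⟩, (hσ _).1.right_mem⟩ else hne.some⟩,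
    fun e => by simpa using (hσ e).1, fun e he => ?_⟩
  simpa [Arcs.map, he, EdgeList.arcs] using congrArg (Sym2.map Fin.val) (hσ ⟨e, he⟩).2

theorem not_isKTrail_of_stuck {G : EdgeList} {k v : ℕ} {D : Arcs ℕ} (hD : D.Same G.m G.arcs)
    (hroot : D.Rooted G.m G.n) (hv : v < G.n) (hdef : k * D.copies G.m v < D.deg G.m v)
    (hstuck : ∀ u < G.n, D.deg G.m u + k ≤ k * D.copies G.m u →
      ∃ X, D.TightAvoiding G.m G.n v X ∧ u ∈ X) : ¬ IsKTrail G.toGraph k := by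
  classical
  rintro ⟨γ, δ, H, φ, hVf, hEf, hconn, hmax, hhom⟩
  have := hVf.to_subtype
  have := Fintype.ofFinite H.vertexSet
  obtain ⟨σ, B, hB, hsame⟩ := hhom.exists_arcs hEf hconn.nonempty
  refine hroot.not_connected_of_stuck (hD.lt fun e => EdgeList.arcs_lt) hv hdef hstuck ?_
    (hsame.trans hD.symm) (fun w => degree_eq_deg_of_isLink hB w ▸ hmax w w.2)
    (hconn.connected_of_isLink hB)
  refine Set.Subset.antisymm (Set.range_subset_iff.2 fun w => (φ w).2) fun u hu => ?_
  obtain ⟨w, hw, hwu⟩ : (⟨u, hu⟩ : Fin G.n) ∈ φ '' H.vertexSet := hhom.image_eq ▸ trivial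
  exact ⟨⟨w, hw⟩, congrArg Fin.val hwu⟩

/-! ### Rooted trees -/

/-- The parent of a vertex in the graph in which edge `e` joins `π e` to its child `e + 1`. -/
def parent (π : ℕ → ℕ) : ℕ → ℕ
  | 0 => 0
  | e + 1 => π e

/-- The edges `π e → e + 1` of the graph with parents `parent π`. -/
def treeArcs (π : ℕ → ℕ) : Arcs ℕ := ⟨π, fun e => e + 1⟩

/-- The graph with vertices `0, …, m` and parents `parent π` is a tree with root `0`. -/
structure IsRootedTree (m : ℕ) (π : ℕ → ℕ) : Prop where
  le : ∀ e < m, π e ≤ m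
  exists_iterate : ∀ w ≤ m, ∃ t, (parent π)^[t] w = 0

@[simp]
theorem parent_succ (π : ℕ → ℕ) (e : ℕ) : parent π (e + 1) = π e := rfl

theorem parent_iterate_zero (π : ℕ → ℕ) (t : ℕ) : (parent π)^[t] 0 = 0 :=
  Function.iterate_fixed rfl t

/-- The list of the edges of `treeArcs π`. -/
def treeEdgeList (m : ℕ) (π : ℕ → ℕ) (h : ∀ e < m, π e ≤ m) : EdgeList where
  n := m + 1
  m := m
  ends e := (⟨π e, Nat.lt_succ_of_le (h e e.2)⟩, e.succ)

theorem arcs_treeEdgeList_same {m : ℕ} {π : ℕ → ℕ} (h : ∀ e < m, π e ≤ m) :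
    (treeEdgeList m π h).arcs.Same m (treeArcs π) := fun e he => by
  simp [EdgeList.arcs, treeEdgeList, treeArcs, he]

namespace IsRootedTree

variable {m : ℕ} {π : ℕ → ℕ}

theorem parent_le (h : IsRootedTree m π) {w : ℕ} (hw : w ≤ m) : parent π w ≤ m := by
  cases w with
  | zero => exact hw
  | succ e => exact h.le e hw

theorem iterate_le (h : IsRootedTree m π) {w : ℕ} (hw : w ≤ m) (t : ℕ) : (parent π)^[t] w ≤ m :=
  Function.Iterate.rec (· ≤ m) hw (fun _ => h.parent_le) t

theorem eq_zero_of_periodic (h : IsRootedTree m π) {w t : ℕ} (hw : w ≤ m) (ht : 0 < t)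
    (hwt : (parent π)^[t] w = w) : w = 0 := by
  obtain ⟨u, hu⟩ := h.exists_iterate w hw
  have hper : (parent π)^[t * u] w = w := Function.IsPeriodicPt.mul_const hwt u
  rw [(Nat.sub_add_cancel (Nat.le_mul_of_pos_left u ht)).symm, Function.iterate_add_apply, hu,
    parent_iterate_zero] at hper
  exact hper.symm

theorem isConnected (h : IsRootedTree m π) : IsConnected (treeEdgeList m π h.le).toGraph := by
  let vtx (w : ℕ) (hw : w < m + 1) : (treeEdgeList m π h.le).toGraph.vertexSet :=
    ⟨(⟨w, hw⟩ : Fin (m + 1)), trivial⟩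
  have hroot (t : ℕ) : ∀ w hw, (parent π)^[t] w = 0 →
      (treeEdgeList m π h.le).toGraph.toSimpleGraph.Reachable (vtx w hw) (vtx 0 m.succ_pos) := by
    induction t with
    | zero => rintro w hw rfl; exact .refl _
    | succ t ih =>
      rintro (_ | e) hw ht
      · exact .refl _
      · have he : e < m := Nat.lt_of_succ_lt_succ hw
        exact (reachable_of_isLink (x := vtx (π e) (Nat.lt_succ_of_le (h.le e he)))
          (y := vtx (e + 1) hw) (e := (⟨e, he⟩ : Fin m)) rfl).symm.trans (ih (π e) _ ht)
  have : Nonempty (treeEdgeList m π h.le).toGraph.vertexSet := ⟨vtx 0 m.succ_pos⟩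
  refine ⟨fun a b => ?_⟩
  obtain ⟨t, ht⟩ := h.exists_iterate _ (Nat.le_of_lt_succ (a.1 : Fin (m + 1)).2)
  obtain ⟨t', ht'⟩ := h.exists_iterate _ (Nat.le_of_lt_succ (b.1 : Fin (m + 1)).2)
  exact (hroot t _ _ ht).trans (hroot t' _ _ ht').symm

theorem isKTree (h : IsRootedTree m π) {k : ℕ} (hdeg : ∀ w ≤ m, (treeArcs π).deg m w ≤ k) :
    IsKTree (treeEdgeList m π h.le).toGraph k :=
  ⟨EdgeList.isTree_of_isConnected h.isConnected rfl, fun v _ =>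
    (EdgeList.degree_toGraph v).trans_le (((arcs_treeEdgeList_same h.le).deg_eq _).trans_le
      (hdeg _ (Nat.le_of_lt_succ (v : Fin (m + 1)).2)))⟩

end IsRootedTree

theorem isHomImageBy_treeEdgeList {G : EdgeList} {π φ : ℕ → ℕ} (h : ∀ e < G.m, π e ≤ G.m)
    (hφ : ∀ w ≤ G.m, φ w < G.n) (honto : ∀ u < G.n, ∃ w ≤ G.m, φ w = u)
    (hsame : ((treeArcs π).map φ).Same G.m G.arcs) :
    IsHomImageBy G.toGraph (treeEdgeList G.m π h).toGraph
      (fun w : Fin (G.m + 1) => (⟨φ w, hφ w (Nat.le_of_lt_succ w.2)⟩ : Fin G.n)) := by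
  refine EdgeList.isHomImageBy_toGraph (G := G) (H := treeEdgeList G.m π h) rfl
    (fun u => ?_) fun e => ?_
  · obtain ⟨w, hw, hwu⟩ := honto u u.2
    exact ⟨(⟨w, Nat.lt_succ_of_le hw⟩ : Fin (G.m + 1)), Fin.ext hwu⟩
  · apply Sym2.map.injective Fin.val_injective
    exact (hsame e e.2).trans (congrArg₂ (fun x y => s(x, y))
      (EdgeList.arcs_src (G := G) (e : Fin G.m)) (EdgeList.arcs_dst (G := G) (e : Fin G.m)))

/-! ### Programs: degrees, searches, reversal of paths -/

/- The memory layout. Registers `0`, `1`, `2` and arrays `0`, `1`, `2` are as `inputState` and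
`Outputs` want them; array `3` contains the ranks of the vertices found by a search and array `4`
the edges by which they were found. -/
local notation "regK" => (0 : ℕ)
local notation "regN" => (1 : ℕ)
local notation "regM" => (2 : ℕ)
local notation "outerIdx" => (3 : ℕ)
local notation "innerIdx" => (4 : ℕ)
local notation "progressFlag" => (5 : ℕ)
local notation "swapTmp" => (6 : ℕ)
local notation "deficientFlag" => (8 : ℕ)
local notation "deficientIdx" => (9 : ℕ)
local notation "countVertex" => (10 : ℕ)
local notation "countIdx" => (11 : ℕ)
local notation "countCapacity" => (12 : ℕ)
local notation "countDegree" => (13 : ℕ)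
local notation "reachStart" => (20 : ℕ)
local notation "reachIdx" => (21 : ℕ)
local notation "reachFlag" => (22 : ℕ)
local notation "reachRank" => (23 : ℕ)
local notation "reverseVertex" => (24 : ℕ)
local notation "reverseEdge" => (25 : ℕ)
local notation "saveIdx" => (27 : ℕ)
local notation "unmarkedFlag" => (28 : ℕ)
local notation "unmarkedIdx" => (29 : ℕ)
local notation "buildIdx" => (30 : ℕ)
local notation "walkFound" => (31 : ℕ)
local notation "walkVertex" => (32 : ℕ)
local notation "walkIdx" => (33 : ℕ)
local notation "srcArr" => (0 : ℕ)
local notation "dstArr" => (1 : ℕ)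
local notation "mapArr" => (2 : ℕ)
local notation "rankArr" => (3 : ℕ)
local notation "predArr" => (4 : ℕ)
local notation "savedSrcArr" => (5 : ℕ)
local notation "savedDstArr" => (6 : ℕ)

/-- The edges stored in the memory. -/
def arcsOf (s : State) : Arcs ℕ := ⟨s.arr srcArr, s.arr dstArr⟩

/-- The memory contains the numbers `k`, `n`, `m` and the edges `D`. -/
structure Holds (k n m : ℕ) (D : Arcs ℕ) (s : State) : Prop where
  k : s.reg regK = k
  n : s.reg regN = n
  m : s.reg regM = m
  arcs : arcsOf s = D

section Holds

variable {k n m : ℕ} {D D' : Arcs ℕ} {s s' : State} {P : Prog}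

theorem Holds.src (h : Holds k n m D s) : s.arr srcArr = D.src := congrArg Arcs.src h.arcs

theorem Holds.dst (h : Holds k n m D s) : s.arr dstArr = D.dst := congrArg Arcs.dst h.arcs

theorem Holds.of_frame_of_arcs (h : Holds k n m D s) (hf : Frame P s s') (hD : arcsOf s' = D')
    (hP : (P.keepsReg regK && P.keepsReg regN && P.keepsReg regM) = true := by rfl) :
    Holds k n m D' s' := by
  simp only [Bool.and_eq_true] at hP
  exact ⟨(hf.reg _ hP.1.1).trans h.k, (hf.reg _ hP.1.2).trans h.n, (hf.reg _ hP.2).trans h.m, hD⟩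

theorem Holds.of_frame (h : Holds k n m D s) (hf : Frame P s s')
    (hP : (P.keepsReg regK && P.keepsReg regN && P.keepsReg regM &&
      P.keepsArr srcArr && P.keepsArr dstArr) = true := by rfl) : Holds k n m D s' := by
  simp only [Bool.and_eq_true] at hP
  refine h.of_frame_of_arcs hf ?_ (by simp [hP])
  rw [← h.arcs, arcsOf, arcsOf, hf.arr _ hP.1.2, hf.arr _ hP.2]

theorem Holds.setReg (h : Holds k n m D s) {r : ℕ} (c : ℕ) (hr : 3 ≤ r := by decide) :
    Holds k n m D (s.setReg r c) where
  k := by rw [State.setReg_reg, if_neg (by omega), h.k]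
  n := by rw [State.setReg_reg, if_neg (by omega), h.n]
  m := by rw [State.setReg_reg, if_neg (by omega), h.m]
  arcs := h.arcs

end Holds

section Count

theorem card_filter_range_succ (p : ℕ → Prop) [DecidablePred p] (j : ℕ) :
    #{e ∈ range (j + 1) | p e} = #{e ∈ range j | p e} + if p j then 1 else 0 := by
  simp only [card_filter, sum_range_succ]

theorem Arcs.copies_succ (D : Arcs ℕ) (j v : ℕ) :
    D.copies (j + 1) v = D.copies j v + if D.dst j = v then 1 else 0 := by
  simp only [copies, indeg, card_filter_range_succ]; omega

theorem Arcs.deg_succ (D : Arcs ℕ) (j v : ℕ) : D.deg (j + 1) v =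
    D.deg j v + (if D.src j = v then 1 else 0) + if D.dst j = v then 1 else 0 := by
  simp only [deg, indeg, card_filter_range_succ]; omega

/-- Compute the degree of the vertex `x` and `k` times the number of its copies. -/
def count (x : Expr) : Prog :=
  .seq (.seq (.assign countVertex x) <| .seq (.assign countDegree (.const 0)) <|
    .cond (.reg countVertex) (.assign countCapacity (.const 0))
      (.assign countCapacity (.reg regK))) <|
  .forTo countIdx regM <| .seq
    (.cond (.ne (.get srcArr (.reg countIdx)) (.reg countVertex)) .skip
      (.assign countDegree (.add (.reg countDegree) (.const 1))))
    (.cond (.ne (.get dstArr (.reg countIdx)) (.reg countVertex)) .skip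
      (.seq (.assign countDegree (.add (.reg countDegree) (.const 1)))
        (.assign countCapacity (.add (.reg countCapacity) (.reg regK)))))

theorem Holds.halts_count {k n m L : ℕ} {D : Arcs ℕ} {s : State} (h : Holds k n m D s)
    (hL : m ≤ L) (x : Expr) :
    Halts L (count x) s fun s' => s'.reg countCapacity = k * D.copies m (x.eval s) ∧
      s'.reg countDegree = D.deg m (x.eval s) := by
  refine .exec_seq rfl (.forTo (fun j s' => s'.reg countCapacity = k * D.copies j (x.eval s) ∧
    s'.reg countDegree = D.deg j (x.eval s)) (h.of_frame (Frame.exec rfl s)).m rfl hL ?_ ?_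
    fun _ h => h)
  · by_cases hx : x.eval s = 0 <;> simp [hx, h.k, Arcs.copies, Arcs.deg, Arcs.indeg]
  · rintro j - s' ⟨hcap, hdeg⟩ hj hf
    have hs' := (h.of_frame (Frame.exec rfl s)).of_frame hf
    have hx : s'.reg countVertex = x.eval s := (hf.reg _ rfl).trans (by
      by_cases h0 : x.eval s = 0 <;> simp [h0])
    refine .exec rfl ?_
    rw [Arcs.copies_succ, Arcs.deg_succ]
    by_cases hsrc : D.src j = x.eval s <;> by_cases hdst : D.dst j = x.eval s <;>
      simp [hs'.src, hs'.dst, hs'.k, hj, hx, hcap, hdeg, hsrc, hdst, mul_add]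

end Count

section Reach

/-- The outcome `rk`, `pr` of the first steps of a search from the vertex `start`: the vertices
found so far are those of non-zero rank, and for each of them, except `start`, `pr` gives an edge by
which it was found from a vertex of smaller rank. -/
structure Marks (D : Arcs ℕ) (n m start : ℕ) (rk pr : ℕ → ℕ) : Prop where
  start_ne : rk start ≠ 0
  pred : ∀ x < n, rk x ≠ 0 → x = start ∨ (pr x < m ∧ D.dst (pr x) = x ∧
    rk (D.src (pr x)) ≠ 0 ∧ rk (D.src (pr x)) < rk x)
  le : ∀ x < n, rk x ≤ n

variable {D : Arcs ℕ} {k n m start L : ℕ} {rk pr : ℕ → ℕ} {s : State}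

theorem Marks.reach (h : Marks D n m start rk pr) (hval : ∀ e < m, D.src e < n ∧ D.dst e < n)
    {x : ℕ} (hx : x < n) (hrk : rk x ≠ 0) : D.Reach m start x := by
  induction hr : rk x using Nat.strong_induction_on generalizing x with
  | _ r ih =>
    rcases h.pred x hx hrk with rfl | ⟨h₁, h₂, h₃, h₄⟩
    · exact .refl
    · exact (ih _ (hr ▸ h₄) (hval _ h₁).1 h₃ rfl).tail ⟨_, h₁, rfl, h₂⟩

theorem Marks.rank_ne_zero (h : Marks D n m start rk pr)
    (hclosed : ∀ e < m, rk (D.src e) ≠ 0 → rk (D.dst e) ≠ 0) {x : ℕ} (hx : D.Reach m start x) :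
    rk x ≠ 0 := by
  induction hx with
  | refl => exact h.start_ne
  | tail _ h' ih =>
    obtain ⟨e, he, rfl, rfl⟩ := h'
    exact hclosed e he ih

theorem Marks.update (h : Marks D n m start rk pr) (hval : ∀ e < m, D.src e < n ∧ D.dst e < n)
    {e c : ℕ} (he : e < m) (hs : rk (D.src e) ≠ 0) (hd : rk (D.dst e) = 0)
    (hle : ∀ x < n, rk x ≤ c) (hc : c + 1 ≤ n) :
    Marks D n m start (Function.update rk (D.dst e) (c + 1)) (Function.update pr (D.dst e) e) := by
  have hne {y : ℕ} (hy : rk y ≠ 0) : y ≠ D.dst e := fun h' => hy (h' ▸ hd)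
  refine ⟨?_, fun x hx hrk => ?_, fun x hx => ?_⟩
  · rw [Function.update_of_ne (hne h.start_ne)]
    exact h.start_ne
  · by_cases hxd : x = D.dst e
    · subst hxd
      rw [Function.update_self, Function.update_self, Function.update_of_ne (hne hs)]
      exact .inr ⟨he, rfl, hs, Nat.lt_succ_of_le (hle _ (hval e he).1)⟩
    · rw [Function.update_of_ne hxd] at hrk
      rcases h.pred x hx hrk with h₁ | ⟨h₁, h₂, h₃, h₄⟩
      · exact .inl h₁
      · rw [Function.update_of_ne hxd, Function.update_of_ne hxd, Function.update_of_ne (hne h₃)]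
        exact .inr ⟨h₁, h₂, h₃, h₄⟩
  · rw [Function.update_apply]
    split_ifs
    exacts [hc, h.le x hx]

theorem card_filter_update_eq_zero {d c : ℕ} (hd : d < n) (h : rk d = 0) :
    #{x ∈ range n | Function.update rk d (c + 1) x = 0} + 1 = #{x ∈ range n | rk x = 0} := by
  rw [← card_erase_add_one (a := d) (s := {x ∈ range n | rk x = 0}) (by simp [hd, h])]
  congr 2
  ext x
  by_cases hx : x = d <;> simp [hx]

/-- Set all ranks to zero. -/
def clearRanks : Prog := .forTo reachIdx regN (.store rankArr (.reg reachIdx) (.const 0))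

theorem Holds.halts_clearRanks (h : Holds k n m D s) (hL : n ≤ L) :
    Halts L clearRanks s fun s' => ∀ x < n, s'.arr rankArr x = 0 := by
  refine .forTo (fun j s' => ∀ x < j, s'.arr rankArr x = 0) h.n rfl hL (by simp) ?_ fun _ h => h
  intro j _ s' hs' hj _
  refine .exec rfl (Nat.forall_lt_succ_right.2 ⟨fun x hx => ?_, by simp [hj]⟩)
  simp [hj, hx.ne, hs' x hx]

/-- If the edge in register `reachIdx` leads from a vertex that has been found to one that has not,
record the latter as found and raise the flag. -/
def reachStep : Prog :=
  .cond (.get rankArr (.get srcArr (.reg reachIdx)))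
    (.cond (.get rankArr (.get dstArr (.reg reachIdx))) .skip <|
      .seq (.assign reachRank (.add (.reg reachRank) (.const 1))) <|
      .seq (.store rankArr (.get dstArr (.reg reachIdx)) (.reg reachRank)) <|
      .seq (.store predArr (.get dstArr (.reg reachIdx)) (.reg reachIdx)) <|
      .assign reachFlag (.const 1))
    .skip

/-- Find the vertices that are reachable from the vertex `x`. -/
def reach (x : Expr) : Prog :=
  .seq (.assign reachStart x) <| .seq clearRanks <|
  .seq (.seq (.store rankArr (.reg reachStart) (.const 1)) (.assign reachRank (.const 1))) <|
  .search reachFlag (.forTo reachIdx regM reachStep)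

/-- The invariant of `reach`, with ranks `rk`. -/
structure ReachInv (k n m : ℕ) (D : Arcs ℕ) (start : ℕ) (rk : ℕ → ℕ) (s : State) : Prop where
  holds : Holds k n m D s
  start_eq : s.reg reachStart = start
  rank : s.arr rankArr = rk
  marks : Marks D n m start rk (s.arr predArr)
  le : ∀ x < n, rk x ≤ s.reg reachRank
  add_card_le : s.reg reachRank + #{x ∈ range n | rk x = 0} ≤ n

theorem ReachInv.setReg (h : ReachInv k n m D start rk s) {r : ℕ} (c : ℕ)
    (hr : 3 ≤ r := by decide) (hne : reachRank ≠ r ∧ reachStart ≠ r := by decide) :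
    ReachInv k n m D start rk (s.setReg r c) where
  holds := h.holds.setReg c hr
  start_eq := by simpa [hne] using h.start_eq
  rank := h.rank
  marks := h.marks
  le := by simpa [hne] using h.le
  add_card_le := by simpa [hne] using h.add_card_le

theorem ReachInv.init (h : Holds k n m D s) (hrk : ∀ x < n, s.arr rankArr x = 0)
    (hstart : s.reg reachStart = start) (hlt : start < n) :
    ReachInv k n m D start (Function.update (s.arr rankArr) start 1)
      (Prog.exec (.seq (.store rankArr (.reg reachStart) (.const 1))
        (.assign reachRank (.const 1))) s) := by
  have hle : ∀ x < n, Function.update (s.arr rankArr) start 1 x ≤ 1 := fun x hx => by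
    rw [Function.update_apply]
    split_ifs
    exacts [le_rfl, by simp [hrk x hx]]
  refine ⟨h.of_frame (Frame.exec rfl s), by simpa using hstart, by simp [hstart],
    ⟨by simp, fun x hx hne => .inl ?_, fun x hx => (hle x hx).trans (by omega)⟩, by simpa using hle,
    ?_⟩
  · by_contra hxs
    exact hne (by rw [Function.update_of_ne hxs, hrk x hx])
  · have hcard := card_filter_update_eq_zero (c := 0) hlt (hrk start hlt)
    rw [filter_true_of_mem (s := range n) fun x hx => hrk x (mem_range.1 hx), card_range,
      zero_add] at hcard
    simp only [Prog.exec, State.setReg_reg, if_true, Expr.eval]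
    omega

theorem ReachInv.halts_reachStep (h : ReachInv k n m D start rk s)
    (hval : ∀ e < m, D.src e < n ∧ D.dst e < n) {e : ℕ} (he : e < m) (hs : s.reg reachIdx = e) :
    Halts L reachStep s (Progress (ReachInv k n m D start) (fun rk => #{x ∈ range n | rk x = 0})
      reachFlag s rk (rk (D.src e) ≠ 0 → rk (D.dst e) ≠ 0)) := by
  by_cases hsrc : rk (D.src e) = 0
  · exact .exec rfl (.inr (by simpa [reachStep, hs, h.holds.src, h.rank, hsrc] using h))
  by_cases hdst : rk (D.dst e) = 0
  · have hcard := card_filter_update_eq_zero (c := s.reg reachRank) (hval e he).2 hdst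
    have hadd := h.add_card_le
    refine .exec rfl (.inl ⟨Function.update rk (D.dst e) (s.reg reachRank + 1),
      ⟨h.holds.of_frame (Frame.exec rfl s), ((Frame.exec rfl s).reg _ rfl).trans h.start_eq, ?_, ?_,
        ?_, ?_⟩, by beta_reduce; omega, ?_⟩)
    · simp [reachStep, hs, h.holds.src, h.holds.dst, h.rank, hsrc, hdst]
    · simpa [reachStep, hs, h.holds.src, h.holds.dst, h.rank, hsrc, hdst] using
        h.marks.update hval he hsrc hdst h.le (by omega)
    · intro x hx
      have := h.le x hx
      rw [Function.update_apply]
      split_ifs <;> simp [reachStep, hs, h.holds.src, h.holds.dst, h.rank, hsrc, hdst]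
      omega
    · simp [reachStep, hs, h.holds.src, h.holds.dst, h.rank, hsrc, hdst]
      omega
    · simp [reachStep, hs, h.holds.src, h.holds.dst, h.rank, hsrc, hdst]
  · exact .exec rfl (.inr (by simpa [reachStep, hs, h.holds.src, h.holds.dst, h.rank, hsrc, hdst]
      using h))

theorem Holds.halts_reach (h : Holds k n m D s) (hval : ∀ e < m, D.src e < n ∧ D.dst e < n)
    {x : Expr} (hx : x.eval s < n) (hnL : n ≤ L) (hmL : m ≤ L) :
    Halts L (reach x) s fun s' =>
      Marks D n m (x.eval s) (s'.arr rankArr) (s'.arr predArr) ∧ s'.reg reachStart = x.eval s ∧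
        ∀ y < n, s'.arr rankArr y ≠ 0 ↔ D.Reach m (x.eval s) y := by
  refine .exec_seq rfl (((h.setReg _).halts_clearRanks hnL).frame.seq fun s₁ ⟨hs₁, hf⟩ => ?_)
  have hstart : s₁.reg reachStart = x.eval s := (hf.reg _ rfl).trans (by simp)
  have hinit := ReachInv.init ((h.setReg _).of_frame hf) hs₁ hstart hx
  refine .exec_seq rfl (.search (Rep := ReachInv k n m D (x.eval s))
    (μ := fun rk => #{x ∈ range n | rk x = 0}) (fun _ _ c h => h.setReg c)
    (fun _ _ h => .scan (fun _ _ c h => h.setReg c) rfl (by decide) hmL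
      (fun e he _ _ h hs => h.halts_reachStep hval he hs) h h.holds.m) hinit ?_
    fun rk s' h hF => ?_)
  · refine (card_lt_card (filter_ssubset.2 ⟨_, mem_range.2 hx, ?_⟩)).trans_le
      ((card_range n).trans_le hnL)
    simp
  · obtain rfl := h.rank
    exact ⟨h.marks, h.start_eq, fun y hy => ⟨h.marks.reach hval hy, h.marks.rank_ne_zero hF⟩⟩

end Reach

section Reverse

variable {D D' D'' : Arcs ℕ} {k n m start e x u v w L : ℕ} {rk pr : ℕ → ℕ} {s : State}

/-- The orientation with edge `e` reversed. -/
def Arcs.swap (D : Arcs ℕ) (e : ℕ) : Arcs ℕ :=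
  ⟨Function.update D.src e (D.dst e), Function.update D.dst e (D.src e)⟩

theorem Arcs.swap_src_self (D : Arcs ℕ) (e : ℕ) : (D.swap e).src e = D.dst e :=
  Function.update_self ..

theorem Arcs.swap_dst_self (D : Arcs ℕ) (e : ℕ) : (D.swap e).dst e = D.src e :=
  Function.update_self ..

theorem Arcs.swap_of_ne (D : Arcs ℕ) (h : x ≠ e) :
    (D.swap e).src x = D.src x ∧ (D.swap e).dst x = D.dst x :=
  ⟨Function.update_of_ne h .., Function.update_of_ne h ..⟩

theorem Arcs.swap_same (D : Arcs ℕ) (e : ℕ) : (D.swap e).Same m D := by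
  intro e' _
  by_cases h : e' = e
  · rw [h, swap_src_self, swap_dst_self, Sym2.eq_swap]
  · rw [(D.swap_of_ne h).1, (D.swap_of_ne h).2]

/-- Orientations `D` and `D'` of the same graph such that `u` has lost and `v` has gained an
entering edge. -/
structure Arcs.Trade (D D' : Arcs ℕ) (m u v : ℕ) : Prop where
  same : D'.Same m D
  indeg : ∀ y, D'.indeg m y + (if u = y then 1 else 0) = D.indeg m y + if v = y then 1 else 0

theorem Arcs.Trade.refl : Trade D D m u u := ⟨.refl, fun _ => rfl⟩

theorem Arcs.Trade.trans (h : Trade D D' m u v) (h' : Trade D' D'' m v w) : Trade D D'' m u w where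
  same := h'.same.trans h.same
  indeg y := by
    have := h.indeg y
    have := h'.indeg y
    omega

theorem Arcs.Trade.swap (D : Arcs ℕ) (he : e < m) :
    Trade D (D.swap e) m (D.dst e) (D.src e) where
  same := D.swap_same e
  indeg y := by
    simp only [Arcs.indeg, card_filter]
    rw [← add_sum_erase _ _ (mem_range.2 he), ← add_sum_erase _ _ (mem_range.2 he),
      sum_congr rfl fun x hx => by rw [(D.swap_of_ne (ne_of_mem_erase hx)).2], D.swap_dst_self]
    omega

/-- Reverse the edge in register `r`. -/
def swapEdge (r : ℕ) : Prog :=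
  .seq (.assign swapTmp (.get srcArr (.reg r))) <|
  .seq (.store srcArr (.reg r) (.get dstArr (.reg r))) <|
  .store dstArr (.reg r) (.reg swapTmp)

theorem arcsOf_exec_swapEdge {r : ℕ} (hr : r ≠ swapTmp) (s : State) :
    arcsOf ((swapEdge r).exec s) = (arcsOf s).swap (s.reg r) := by
  simp [arcsOf, swapEdge, Arcs.swap, hr]

/-- Reverse the path by which the last search has found the vertex `x`. -/
def reverse (x : Expr) : Prog :=
  .seq (.assign reverseVertex x) <| .loop (.ne (.reg reverseVertex) (.reg reachStart)) <|
    .seq (.seq (.assign reverseEdge (.get predArr (.reg reverseVertex)))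
      (.assign reverseVertex (.get srcArr (.reg reverseEdge)))) <|
    swapEdge reverseEdge

/-- The situation after a path to `u` has been reversed from `u` back to `x`. -/
structure ReverseInv (D : Arcs ℕ) (n m : ℕ) (rk : ℕ → ℕ) (u : ℕ) (D' : Arcs ℕ) (x : ℕ) :
    Prop where
  lt : x < n
  rank_ne : rk x ≠ 0
  trade : D.Trade D' m u x
  agree : ∀ e, m ≤ e ∨ rk (D.dst e) ≤ rk x → D'.src e = D.src e ∧ D'.dst e = D.dst e

theorem ReverseInv.step (h : ReverseInv D n m rk u D' x)
    (hval : ∀ e < m, D.src e < n ∧ D.dst e < n) (hmk : Marks D n m start rk pr)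
    (hx : x ≠ start) :
    ReverseInv D n m rk u (D'.swap (pr x)) (D'.src (pr x)) ∧ rk (D'.src (pr x)) < rk x := by
  obtain ⟨hlt, hdst, hne, hrk⟩ := (hmk.pred x h.lt h.rank_ne).resolve_left hx
  obtain ⟨hsrc', hdst'⟩ := h.agree (pr x) (.inr (by rw [hdst]))
  have htr := Arcs.Trade.swap D' hlt
  rw [hdst', hdst, hsrc'] at htr
  rw [hsrc']
  refine ⟨⟨(hval _ hlt).1, hne, h.trade.trans htr, fun e he => ?_⟩, hrk⟩
  have hne : e ≠ pr x := by rintro rfl; rw [hdst] at he; omega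
  rw [(D'.swap_of_ne hne).1, (D'.swap_of_ne hne).2]
  exact h.agree e (he.imp_right fun he => he.trans hrk.le)

theorem Holds.halts_reverse (h : Holds k n m D s) {x : Expr} (hx : x.eval s < n)
    (hval : ∀ e < m, D.src e < n ∧ D.dst e < n)
    (hmk : Marks D n m start (s.arr rankArr) (s.arr predArr)) (hstart : s.reg reachStart = start)
    (hrk : s.arr rankArr (x.eval s) ≠ 0) (hL : n ≤ L) :
    Halts L (reverse x) s fun s' => ∃ D', Holds k n m D' s' ∧ D.Trade D' m (x.eval s) start ∧
      ∀ e ≥ m, D'.src e = D.src e ∧ D'.dst e = D.dst e := by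
  refine .exec_seq rfl (.loop (fun D' s' => Holds k n m D' s' ∧
    ReverseInv D n m (s.arr rankArr) (x.eval s) D' (s'.reg reverseVertex))
    (fun _ s' => s.arr rankArr (s'.reg reverseVertex)) ?_ (a := D) ⟨h.setReg _, ?_⟩ ?_ ?_)
  · rintro D' s' ⟨hD', hinv⟩ hf hne
    have hstart' : s'.reg reachStart = start := (hf.reg _ rfl).trans (by simpa using hstart)
    have hpred : s'.arr predArr = s.arr predArr := hf.arr _ rfl
    obtain ⟨hstep, hlt⟩ := hinv.step hval hmk fun h => hne (Expr.eval_ne.2 (h.trans hstart'.symm))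
    refine .exec rfl ⟨D'.swap (s.arr predArr (s'.reg reverseVertex)),
      ⟨hD'.of_frame_of_arcs (Frame.exec rfl s') ?_, ?_⟩, ?_⟩
    · rw [Prog.exec, arcsOf_exec_swapEdge (by decide), ← hD'.arcs]
      simp [arcsOf, hpred]
    · simpa [swapEdge, hD'.src, hpred] using hstep
    · simpa [swapEdge, hD'.src, hpred] using hlt
  · exact ⟨by simpa using hx, by simpa using hrk, by simpa using .refl, fun _ _ => ⟨rfl, rfl⟩⟩
  · simpa using (hmk.le _ hx).trans hL
  · rintro D' s' ⟨hD', hinv⟩ hf hne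
    have hstart' : s'.reg reachStart = start := (hf.reg _ rfl).trans (by simpa using hstart)
    have hend : s'.reg reverseVertex = start := (Expr.eval_ne.1 hne).trans hstart'
    exact ⟨D', hD', hend ▸ hinv.trade, fun e he => hinv.agree e (.inl he)⟩

end Reverse

section OrientationSearch

/-! ### Finding the orientation -/

namespace Arcs

variable {D D' : Arcs ℕ} {n m k u v e : ℕ}

theorem Reach.swap {a b : ℕ} (h : D.Reach m a b) (he : ¬ D.Reach m a (D.src e)) :
    (D.swap e).Reach m a b := by
  induction h with
  | refl => exact .refl
  | @tail b c hb h' ih =>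
    obtain ⟨e', he', rfl, rfl⟩ := h'
    have hne : e' ≠ e := fun h => he (h ▸ hb)
    exact ih.tail ⟨e', he', D.swap_of_ne hne⟩

open Classical in
/-- The vertices that are not reachable from `a`. -/
noncomputable def unreached (D : Arcs ℕ) (m n a : ℕ) : Finset ℕ := {x ∈ range n | ¬ D.Reach m a x}

theorem mem_unreached {a x : ℕ} : x ∈ D.unreached m n a ↔ x < n ∧ ¬ D.Reach m a x := by
  simp [unreached]

theorem unreached_subset (D : Arcs ℕ) (m n a : ℕ) : D.unreached m n a ⊆ range n := fun _ hx =>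
  mem_range.2 (mem_unreached.1 hx).1

theorem card_unreached_swap_lt (hval : ∀ e < m, D.src e < n ∧ D.dst e < n) (he : e < m) {a : ℕ}
    (hdst : D.Reach m a (D.dst e)) (hsrc : ¬ D.Reach m a (D.src e)) :
    #((D.swap e).unreached m n a) < #(D.unreached m n a) := by
  refine card_lt_card ((ssubset_iff_of_subset fun x hx => ?_).2
    ⟨D.src e, mem_unreached.2 ⟨(hval e he).1, hsrc⟩, fun h => ?_⟩)
  · rw [mem_unreached] at hx ⊢
    exact ⟨hx.1, fun h => hx.2 (h.swap hsrc)⟩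
  · exact (mem_unreached.1 h).2
      ((hdst.swap hsrc).tail ⟨e, he, D.swap_src_self e, D.swap_dst_self e⟩)

theorem enter_unreached (hval : ∀ e < m, D.src e < n ∧ D.dst e < n) (a : ℕ) :
    D.enter m (D.unreached m n a) = 0 := by
  rw [enter, card_eq_zero, filter_eq_empty_iff]
  rintro e he ⟨h₁, h₂⟩
  have he := mem_range.1 he
  rw [mem_unreached, not_and_not_right] at h₁
  exact (mem_unreached.1 h₂).2 ((h₁ (hval e he).1).tail ⟨e, he, rfl, rfl⟩)

theorem Rooted.tightAvoiding_unreached (hroot : D.Rooted m n)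
    (hval : ∀ e < m, D.src e < n ∧ D.dst e < n) (hne : (D.unreached m n v).Nonempty) :
    D.TightAvoiding m n v (D.unreached m n v) where
  subset := D.unreached_subset m n v
  nonempty := hne
  notMem h := (mem_unreached.1 h).2 .refl
  enter_eq := le_antisymm ((enter_unreached hval v).trans_le (Nat.zero_le _))
    (hroot.le_enter (D.unreached_subset m n v) hne)

/-- If the trade of a copy of `u` for a copy of `v` makes vertices unreachable, then one edge
entered the set of these vertices before, and the trade has removed it. -/
theorem Trade.tightAvoiding_unreached (h : D.Trade D' m u v)
    (hval : ∀ e < m, D.src e < n ∧ D.dst e < n) (hroot : D.Rooted m n)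
    (hne : (D'.unreached m n 0).Nonempty) :
    D.TightAvoiding m n v (D'.unreached m n 0) ∧ u ∈ D'.unreached m n 0 := by
  set X := D'.unreached m n 0
  have hsub : X ⊆ range n := D'.unreached_subset m n 0
  have h0 : 0 ∉ X := fun h => (mem_unreached.1 h).2 .refl
  have henter := hroot.le_enter hsub hne
  have henter' : D'.enter m X = 0 := enter_unreached (h.same.lt hval) 0
  have hsum := sum_congr (rfl : X = X) fun y _ => h.indeg y
  simp only [sum_add_distrib, sum_indeg, h.same.inner_eq, sum_ite_eq, henter'] at hsum
  rw [if_neg h0] at henter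
  have huv : u ∈ X ∧ v ∉ X ∧ D.enter m X = 1 := by
    by_cases hu : u ∈ X <;> by_cases hv : v ∈ X <;> simp [hu, hv] at hsum ⊢ <;> omega
  exact ⟨⟨hsub, hne, huv.2.1, by rw [if_neg h0, huv.2.2]⟩, huv.1⟩

/-- The unmet demand for copies. -/
def deficiency (D : Arcs ℕ) (n m k : ℕ) : ℕ := ∑ v ∈ range n, (D.deg m v - k * D.copies m v)

theorem deg_le (D : Arcs ℕ) (m v : ℕ) : D.deg m v ≤ m + m :=
  add_le_add ((card_filter_le _ _).trans_eq (card_range m))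
    ((card_filter_le _ _).trans_eq (card_range m))

theorem deficiency_le (D : Arcs ℕ) (n m k : ℕ) : D.deficiency n m k ≤ n * (m + m) := by
  have : ∀ v ∈ range n, D.deg m v - k * D.copies m v ≤ m + m := fun v _ =>
    (Nat.sub_le _ _).trans (D.deg_le m v)
  simpa [deficiency] using sum_le_card_nsmul _ _ _ this

theorem Trade.copies (h : D.Trade D' m u v) (y : ℕ) :
    D'.copies m y + (if u = y then 1 else 0) = D.copies m y + if v = y then 1 else 0 := by
  have := h.indeg y
  simp only [Arcs.copies]
  omega

theorem Trade.deficiency_lt (h : D.Trade D' m u v) (hv : v < n) (hk : 0 < k)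
    (hdef : k * D.copies m v < D.deg m v) (hsur : D.deg m u + k ≤ k * D.copies m u) :
    D'.deficiency n m k < D.deficiency n m k := by
  have huv : u ≠ v := by rintro rfl; omega
  refine sum_lt_sum (fun y _ => ?_) ⟨v, mem_range.2 hv, ?_⟩
  · rw [h.same.deg_eq]
    rcases eq_or_ne u y with rfl | huy
    · have hcopies := h.copies u
      rw [if_pos rfl, if_neg huv.symm, add_zero] at hcopies
      rw [← hcopies, mul_add] at hsur
      omega
    · have hcopies := h.copies y
      rw [if_neg huy, add_zero] at hcopies
      exact Nat.sub_le_sub_left (Nat.mul_le_mul_left k (by omega)) _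
  · have hcopies := h.copies v
    rw [if_neg huv, if_pos rfl, add_zero] at hcopies
    rw [h.same.deg_eq, hcopies, mul_add]
    omega

/-- No copy of `u` can be traded for a copy of `v`. -/
def Blocked (D : Arcs ℕ) (n m k v u : ℕ) : Prop :=
  k * D.copies m v < D.deg m v → D.deg m u + k ≤ k * D.copies m u →
    ∃ X, D.TightAvoiding m n v X ∧ u ∈ X

end Arcs

variable {k n m u v L : ℕ} {D D' D₀ : Arcs ℕ} {s : State}

section Orient

/-- Reverse the edge in register `outerIdx` if only its head is reachable from `0`. -/
def orientStep : Prog :=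
  .seq (reach (.const 0)) <| .cond (.get rankArr (.get dstArr (.reg outerIdx)))
    (.cond (.get rankArr (.get srcArr (.reg outerIdx))) .skip <|
      .seq (swapEdge outerIdx) (.assign progressFlag (.const 1)))
    .skip

/-- Reverse edges until all vertices are reachable from `0`. -/
def orient : Prog := .search progressFlag (.forTo outerIdx regM orientStep)

theorem Holds.halts_orientStep (h : Holds k n m D s) (hsame : D.Same m D₀)
    (hval : ∀ e < m, D.src e < n ∧ D.dst e < n) (hn : 0 < n) (hnL : n ≤ L) (hmL : m ≤ L) {e : ℕ}
    (he : e < m) (hs : s.reg outerIdx = e) :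
    Halts L orientStep s (Progress (fun D s => Holds k n m D s ∧ D.Same m D₀)
      (fun D => #(D.unreached m n 0)) progressFlag s D
      (D.Reach m 0 (D.dst e) → D.Reach m 0 (D.src e))) := by
  refine (h.halts_reach hval (x := .const 0) hn hnL hmL).frame.seq
    fun s₁ ⟨⟨_, _, hreach⟩, hf⟩ => .exec rfl ?_
  have h₁ := h.of_frame hf
  have he₁ : s₁.reg outerIdx = e := (hf.reg _ rfl).trans hs
  have hflag : s₁.reg progressFlag = s.reg progressFlag := hf.reg _ rfl
  have hsrc := hreach _ (hval e he).1
  have hdst := hreach _ (hval e he).2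
  by_cases hd : s₁.arr rankArr (D.dst e) = 0
  · have hd' := mt hdst.2 (not_not.2 hd)
    exact .inr (by simpa [he₁, h₁.dst, hd, hflag] using ⟨⟨h₁, hsame⟩, fun h => absurd h hd'⟩)
  by_cases hs : s₁.arr rankArr (D.src e) = 0
  · refine .inl ⟨D.swap e, ⟨?_, (D.swap_same e).trans hsame⟩,
      Arcs.card_unreached_swap_lt hval he (hdst.1 hd) (mt hsrc.2 (not_not.2 hs)), ?_⟩
    · have hswap := h₁.of_frame_of_arcs (Frame.exec rfl s₁)
        (arcsOf_exec_swapEdge (r := outerIdx) (by decide) s₁)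
      rw [h₁.arcs, he₁] at hswap
      simpa [he₁, h₁.src, h₁.dst, hd, hs] using hswap.setReg 1
    · simp [he₁, h₁.src, h₁.dst, hd, hs]
  · exact .inr (by
      simpa [he₁, h₁.src, h₁.dst, hd, hs, hflag] using ⟨⟨h₁, hsame⟩, fun _ => hsrc.1 hs⟩)

theorem Holds.halts_orient (h : Holds k n m D₀ s) (hval : ∀ e < m, D₀.src e < n ∧ D₀.dst e < n)
    (hn : 0 < n) (hnL : n < L) (hmL : m ≤ L) :
    Halts L orient s fun s' => ∃ D, Holds k n m D s' ∧ D.Same m D₀ ∧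
      ∀ e < m, D.Reach m 0 (D.dst e) → D.Reach m 0 (D.src e) := by
  have hreg (D : Arcs ℕ) (s : State) {r : ℕ} (c : ℕ) (h : Holds k n m D s ∧ D.Same m D₀)
      (hr : 3 ≤ r := by decide) : Holds k n m D (s.setReg r c) ∧ D.Same m D₀ :=
    ⟨h.1.setReg c hr, h.2⟩
  refine .search (Rep := fun D s => Holds k n m D s ∧ D.Same m D₀)
    (μ := fun D => #(D.unreached m n 0)) (fun D s c h => hreg D s c h) (fun D s h => ?_)
    ⟨h, .refl⟩ (((card_le_card (D₀.unreached_subset m n 0)).trans_eq (card_range n)).trans_lt hnL)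
    (fun D s h hF => ⟨D, h.1, h.2, hF⟩)
  exact .scan (fun D s c h => hreg D s c h) rfl (by decide) hmL (fun e he D s h hs =>
    h.1.halts_orientStep h.2 (h.2.lt hval) hn hnL.le hmL he hs) h h.1.m

end Orient

section Trade

/-- Copy the first `m` entries of array `a` to array `b`. -/
def copyArr (a b : ℕ) : Prog :=
  .forTo saveIdx regM (.store b (.reg saveIdx) (.get a (.reg saveIdx)))

theorem halts_copyArr {a b : ℕ} (hab : a ≠ b) (hm : s.reg regM = m) (hL : m ≤ L) :
    Halts L (copyArr a b) s fun s' =>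
      s'.arr b = fun e => if e < m then s.arr a e else s.arr b e := by
  refine .forTo (fun j s' => s'.arr b = fun e => if e < j then s.arr a e else s.arr b e) hm rfl hL
    (by simp) ?_ fun _ h => h
  intro j _ s' hs' hj hf
  have ha : s'.arr a = s.arr a := hf.arr a (by simpa [Prog.forTo, Prog.keepsArr] using hab.symm)
  refine .exec rfl ?_
  ext e
  rcases lt_trichotomy e j with he | rfl | he
  · simp [hj, hs', he, he.ne, Nat.lt_succ_of_lt he]
  · simp [hj, ha]
  · simp [hj, hs', he.ne', he.not_gt, show ¬ e < j + 1 by omega]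

/-- Back up the edges, so that the reversal of a path can be undone. -/
def saveArcs : Prog := .seq (copyArr srcArr savedSrcArr) (copyArr dstArr savedDstArr)

/-- Undo all changes to the edges since the last backup. -/
def restoreArcs : Prog := .seq (copyArr savedSrcArr srcArr) (copyArr savedDstArr dstArr)

theorem Holds.halts_saveArcs (h : Holds k n m D s) (hL : m ≤ L) :
    Halts L saveArcs s fun s' =>
      ∀ e < m, s'.arr savedSrcArr e = D.src e ∧ s'.arr savedDstArr e = D.dst e := by
  refine (halts_copyArr (by decide) h.m hL).frame.seq fun s₁ ⟨hsrc, hf⟩ => ?_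
  have h₁ := h.of_frame hf
  refine (halts_copyArr (by decide) h₁.m hL).frame.mono fun s₂ ⟨hdst, hf⟩ e he => ?_
  rw [hf.arr savedSrcArr rfl, hsrc, hdst, h₁.dst, h.src]
  simp [he]

theorem Holds.halts_restoreArcs (h : Holds k n m D' s)
    (hsaved : ∀ e < m, s.arr savedSrcArr e = D.src e ∧ s.arr savedDstArr e = D.dst e)
    (hge : ∀ e ≥ m, D'.src e = D.src e ∧ D'.dst e = D.dst e) (hL : m ≤ L) :
    Halts L restoreArcs s fun s' => Holds k n m D s' := by
  refine Halts.mono (Halts.frame (.seq (halts_copyArr (by decide) h.m hL).frame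
    fun s₁ ⟨hsrc, hf₁⟩ => (halts_copyArr (by decide) ((hf₁.reg _ rfl).trans h.m) hL).frame.mono
      fun s₂ ⟨hdst, hf₂⟩ => ?_)) fun s' ⟨hD, hf⟩ => h.of_frame_of_arcs hf hD
  have hsrc₂ : s₂.arr srcArr = D.src := by
    rw [hf₂.arr srcArr rfl, hsrc, h.src]
    ext e
    rcases lt_or_ge e m with he | he
    · simp [he, hsaved e he]
    · simp [he.not_gt, hge e he]
  have hdst₂ : s₂.arr dstArr = D.dst := by
    rw [hdst, hf₁.arr savedDstArr rfl, hf₁.arr dstArr rfl, h.dst]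
    ext e
    rcases lt_or_ge e m with he | he
    · simp [he, hsaved e he]
    · simp [he.not_gt, hge e he]
  rw [arcsOf, hsrc₂, hdst₂]

/-- Raise a flag if some vertex is not reachable from `0`. -/
def checkRooted : Prog :=
  .seq (reach (.const 0)) <| .seq (.assign unmarkedFlag (.const 0)) <| .forTo unmarkedIdx regN <|
    .cond (.get rankArr (.reg unmarkedIdx)) .skip (.assign unmarkedFlag (.const 1))

theorem Holds.halts_checkRooted (h : Holds k n m D s) (hval : ∀ e < m, D.src e < n ∧ D.dst e < n)
    (hn : 0 < n) (hnL : n ≤ L) (hmL : m ≤ L) :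
    Halts L checkRooted s fun s' => s'.reg unmarkedFlag = 0 ↔ D.Rooted m n := by
  refine (h.halts_reach hval (x := .const 0) hn hnL hmL).frame.seq
    fun s₁ ⟨⟨_, _, hreach⟩, hf⟩ => .exec_seq rfl (.forTo
      (fun j s' => s'.reg unmarkedFlag = 0 ↔ ∀ x < j, D.Reach m 0 x)
      ((h.of_frame hf).setReg 0).n rfl hnL (by simp) ?_ fun _ h => h)
  intro j hj s' hs' hidx hf
  have hrk : s'.arr rankArr = s₁.arr rankArr := hf.arr _ rfl
  have hreach : s₁.arr rankArr j ≠ 0 ↔ D.Reach m 0 j := hreach j hj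
  refine .exec rfl ?_
  rw [Nat.forall_lt_succ_right, ← hs', ← hreach]
  by_cases hx : s₁.arr rankArr j = 0 <;> simp [hidx, hrk, hx]

/-- Reverse the path that has just been found from the vertex in register `outerIdx` to the vertex
in register `innerIdx`, unless this makes a vertex unreachable from `0`. -/
def tryReverse : Prog :=
  .seq saveArcs <| .seq (reverse (.reg innerIdx)) <| .seq checkRooted <|
    .cond (.reg unmarkedFlag) restoreArcs (.assign progressFlag (.const 1))

theorem Holds.halts_tryReverse (h : Holds k n m D s)
    (hval : ∀ e < m, D.src e < n ∧ D.dst e < n) (hroot : D.Rooted m n)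
    (hmk : Marks D n m v (s.arr rankArr) (s.arr predArr)) (hv : s.reg reachStart = v)
    (hu : s.reg innerIdx = u) (hun : u < n) (hrk : s.arr rankArr u ≠ 0) (hnL : n ≤ L)
    (hmL : m ≤ L) :
    Halts L tryReverse s fun s' =>
      (∃ D', Holds k n m D' s' ∧ D.Trade D' m u v ∧ D'.Rooted m n ∧ s'.reg progressFlag = 1) ∨
      (Holds k n m D s' ∧ s'.reg progressFlag = s.reg progressFlag ∧
        ∃ X, D.TightAvoiding m n v X ∧ u ∈ X) := by
  refine (h.halts_saveArcs hmL).frame.seq fun s₁ ⟨hsaved, hf₁⟩ => ?_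
  have hu₁ : s₁.reg innerIdx = u := (hf₁.reg _ rfl).trans hu
  have hreverse := (h.of_frame hf₁).halts_reverse (x := .reg innerIdx) (L := L) (start := v)
    (by simpa [hu₁] using hun) hval (by simpa [hf₁.arr rankArr rfl, hf₁.arr predArr rfl] using hmk)
    ((hf₁.reg _ rfl).trans hv) (by simpa [hu₁, hf₁.arr rankArr rfl] using hrk) hnL
  simp only [Expr.eval, hu₁] at hreverse
  refine hreverse.frame.seq fun s₂ ⟨⟨D', h₂, htrade, hge⟩, hf₂⟩ => ?_
  refine (h₂.halts_checkRooted (htrade.same.lt hval) (by omega) hnL hmL).frame.seq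
    fun s₃ ⟨hrooted, hf₃⟩ => .cond (fun hflag => ?_) fun hflag => ?_
  · have h₃ := h₂.of_frame hf₃
    rw [Expr.eval, Ne, hrooted] at hflag
    refine (h₃.halts_restoreArcs (fun e he => ?_) hge hmL).frame.mono
      fun s₄ ⟨h₄, hf₄⟩ => .inr ⟨h₄, ?_, _, htrade.tightAvoiding_unreached hval hroot ?_⟩
    · rw [hf₃.arr savedSrcArr rfl, hf₃.arr savedDstArr rfl, hf₂.arr savedSrcArr rfl,
        hf₂.arr savedDstArr rfl]
      exact hsaved e he
    · rw [hf₄.reg _ rfl, hf₃.reg _ rfl, hf₂.reg _ rfl, hf₁.reg _ rfl]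
    · simp only [Arcs.Rooted, not_forall] at hflag
      obtain ⟨x, hx, hx'⟩ := hflag
      exact ⟨x, Arcs.mem_unreached.2 ⟨hx, hx'⟩⟩
  · exact .exec rfl (.inl ⟨D', (h₂.of_frame hf₃).setReg 1, htrade, hrooted.1 hflag, rfl⟩)

/-- Trade a copy of the vertex in register `innerIdx` for a copy of the vertex in register
`outerIdx` if this is possible and decreases the deficiency. -/
def trade : Prog :=
  .seq (count (.reg outerIdx)) <| .cond (.sub (.reg countDegree) (.reg countCapacity))
    (.seq (count (.reg innerIdx)) <|
      .cond (.sub (.add (.reg countDegree) (.reg regK)) (.reg countCapacity)) .skip <|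
      .seq (reach (.reg outerIdx)) <| .cond (.get rankArr (.reg innerIdx)) tryReverse .skip)
    .skip

theorem Holds.halts_trade (h : Holds k n m D s) (hsame : D.Same m D₀) (hroot : D.Rooted m n)
    (hval : ∀ e < m, D.src e < n ∧ D.dst e < n) (hk : 0 < k) (hv : v < n) (hu : u < n)
    (hsv : s.reg outerIdx = v) (hsu : s.reg innerIdx = u) (hnL : n ≤ L) (hmL : m ≤ L) :
    Halts L trade s (Progress (fun D s => Holds k n m D s ∧ D.Same m D₀ ∧ D.Rooted m n)
      (fun D => D.deficiency n m k) progressFlag s D (D.Blocked n m k v u)) := by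
  refine (h.halts_count hmL (.reg outerIdx)).frame.seq fun s₁ ⟨⟨hcap, hdeg⟩, hf₁⟩ => .cond
    (fun hv₁ => ?_) fun hv₁ => .exec rfl (.inr ⟨⟨h.of_frame hf₁, hsame, hroot⟩, hf₁.reg _ rfl,
      fun hv₁' => ?_⟩) <;> simp only [Expr.eval, hcap, hdeg, hsv] at hv₁
  swap
  · omega
  have hsu₁ : s₁.reg innerIdx = u := (hf₁.reg _ rfl).trans hsu
  refine ((h.of_frame hf₁).halts_count hmL (.reg innerIdx)).frame.seq fun s₂ ⟨⟨hcap, hdeg⟩, hf₂⟩ =>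
    ?_
  have h₂ := (h.of_frame hf₁).of_frame hf₂
  have hsv₂ : s₂.reg outerIdx = v := ((hf₂.reg _ rfl).trans (hf₁.reg _ rfl)).trans hsv
  have hfl₂ : s₂.reg progressFlag = s.reg progressFlag := (hf₂.reg _ rfl).trans (hf₁.reg _ rfl)
  refine .cond (fun hu₂ => .exec rfl (.inr ⟨⟨h₂, hsame, hroot⟩, hfl₂, fun _ hu₂' => ?_⟩))
    fun hu₂ => ?_ <;> simp only [Expr.eval, hcap, hdeg, hsu₁, h₂.k] at hu₂
  · omega
  have hreach := h₂.halts_reach hval (x := .reg outerIdx) (by simpa [hsv₂] using hv) hnL hmL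
  simp only [Expr.eval, hsv₂] at hreach
  refine hreach.frame.seq fun s₃ ⟨⟨hmk, hstart, hreach⟩, hf₃⟩ => ?_
  have h₃ := h₂.of_frame hf₃
  have hsu₃ : s₃.reg innerIdx = u := ((hf₃.reg _ rfl).trans (hf₂.reg _ rfl)).trans hsu₁
  have hfl₃ : s₃.reg progressFlag = s.reg progressFlag := (hf₃.reg _ rfl).trans hfl₂
  refine .cond (fun hrk => ?_) fun hrk => ?_ <;> rw [Expr.eval, Expr.eval, hsu₃] at hrk
  · refine (h₃.halts_tryReverse hval hroot hmk hstart hsu₃ hu hrk hnL hmL).mono fun s₄ h₄ => ?_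
    rcases h₄ with ⟨D', h₄, htrade, hroot', hfl⟩ | ⟨h₄, hfl, hX⟩
    · exact .inl ⟨D', ⟨h₄, htrade.same.trans hsame, hroot'⟩,
        htrade.deficiency_lt hv hk (by omega) (by omega), hfl⟩
    · exact .inr ⟨⟨h₄, hsame, hroot⟩, hfl.trans hfl₃, fun _ _ => hX⟩
  · have huX := Arcs.mem_unreached.2 ⟨hu, fun h => (hreach u hu).2 h hrk⟩
    exact .exec rfl (.inr ⟨⟨h₃, hsame, hroot⟩, hfl₃, fun _ _ =>
      ⟨_, hroot.tightAvoiding_unreached hval ⟨u, huX⟩, huX⟩⟩)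

/-- Trade copies as long as this is possible and decreases the deficiency. -/
def tradeAll : Prog :=
  .search progressFlag <| .forTo outerIdx regN <| .forTo innerIdx regN trade

theorem Holds.halts_tradeAll (h : Holds k n m D s) (hval : ∀ e < m, D₀.src e < n ∧ D₀.dst e < n)
    (hk : 0 < k) (hsame : D.Same m D₀) (hroot : D.Rooted m n) (hnL : n ≤ L) (hmL : m ≤ L)
    (hL : n * (m + m) < L) :
    Halts L tradeAll s fun s' => ∃ D, Holds k n m D s' ∧ D.Same m D₀ ∧ D.Rooted m n ∧
      ∀ v < n, ∀ u < n, D.Blocked n m k v u := by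
  refine .search₂ (Rep := fun D s => Holds k n m D s ∧ D.Same m D₀ ∧ D.Rooted m n)
    (μ := fun D => D.deficiency n m k) (F := fun D v u => D.Blocked n m k v u)
    (fun r hr D s x h => ⟨h.1.setReg x ?_, h.2⟩) (fun D s h => h.1.n) (fun D s h => h.1.n)
    (by decide) (by decide) (by decide) hnL hnL ?_ ⟨h, hsame, hroot⟩
    ((D.deficiency_le n m k).trans_lt hL) fun D s h hF => ⟨D, h.1, h.2.1, h.2.2, hF⟩
  · simp only [List.mem_cons, List.not_mem_nil, or_false] at hr
    omega
  · rintro v hv u hu D s ⟨h, hsame, hroot⟩ hsv hsu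
    exact h.halts_trade hsame hroot (hsame.lt hval) hk hv hu hsv hsu hnL hmL

end Trade

end OrientationSearch

section TreesOver

/-! ### Trees over a graph -/

namespace IsRootedTree

variable {m : ℕ} {π : ℕ → ℕ}

theorem exists_iterate_le (h : IsRootedTree m π) {w : ℕ} (hw : w ≤ m) :
    ∃ t ≤ m, (parent π)^[t] w = 0 := by
  classical
  have hex := h.exists_iterate w hw
  refine ⟨Nat.find hex, ?_, Nat.find_spec hex⟩
  have hne {i j : ℕ} (hij : i < j) (hj : j < Nat.find hex + 1) :
      (parent π)^[i] w ≠ (parent π)^[j] w := fun heq => by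
    refine Nat.find_min hex (m := i) (by omega)
      (h.eq_zero_of_periodic (h.iterate_le hw i) (Nat.sub_pos_of_lt hij) ?_)
    rw [← Function.iterate_add_apply, Nat.sub_add_cancel hij.le, heq]
  have hcard := card_le_card_of_injOn (s := range (Nat.find hex + 1)) (t := range (m + 1))
    (fun i => (parent π)^[i] w) (fun i _ => mem_coe.2 (mem_range.2 (Nat.lt_succ_of_le
      (h.iterate_le hw i)))) fun i hi j hj heq => ?_
  · simpa using hcard
  · rw [mem_coe, mem_range] at hi hj
    by_contra hij
    exact (lt_or_gt_of_ne hij).elim (fun hij => hne hij hj heq) fun hij => hne hij hi heq.symm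

theorem forall_iterate_ne_iff (h : IsRootedTree m π) {w c : ℕ} (hw : w ≤ m) (hc : c ≠ 0) :
    (∀ t < m + 1, (parent π)^[t] w ≠ c) ↔ ∀ t, (parent π)^[t] w ≠ c := by
  refine ⟨fun hne t ht => ?_, fun hne t _ => hne t⟩
  obtain ⟨u, hu, hu0⟩ := h.exists_iterate_le hw
  rcases lt_or_ge t (m + 1) with htm | htm
  · exact hne t htm ht
  · rw [← Nat.sub_add_cancel (by omega : u ≤ t), Function.iterate_add_apply, hu0,
      parent_iterate_zero] at ht
    exact hc ht.symm

theorem update (h : IsRootedTree m π) {e b : ℕ} (hb : b ≤ m)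
    (hanc : ∀ t, (parent π)^[t] b ≠ e + 1) : IsRootedTree m (Function.update π e b) := by
  have hpar {w : ℕ} (hw : w ≠ e + 1) : parent (Function.update π e b) w = parent π w := by
    cases w with
    | zero => rfl
    | succ f => exact Function.update_of_ne (fun hf => hw (congrArg _ hf)) _ _
  have hiter (t : ℕ) : (parent (Function.update π e b))^[t] b = (parent π)^[t] b := by
    induction t with
    | zero => rfl
    | succ t ih =>
      rw [Function.iterate_succ_apply', Function.iterate_succ_apply', ih, hpar (hanc t)]
  obtain ⟨u, hu⟩ := h.exists_iterate b hb
  have hroot (t : ℕ) : ∀ w, (parent π)^[t] w = 0 →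
      ∃ t, (parent (Function.update π e b))^[t] w = 0 := by
    induction t with
    | zero => exact fun w hw => ⟨0, hw⟩
    | succ t ih =>
      intro w hw
      rcases eq_or_ne w (e + 1) with rfl | hwe
      · exact ⟨u + 1, by
          rw [Function.iterate_succ_apply, parent_succ, Function.update_self, hiter, hu]⟩
      · obtain ⟨t', ht'⟩ := ih _ hw
        exact ⟨t' + 1, by rw [Function.iterate_succ_apply, hpar hwe, ht']⟩
  refine ⟨fun f hf => ?_, fun w hw => (h.exists_iterate w hw).elim fun t ht => hroot t w ht⟩
  rw [Function.update_apply]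
  split_ifs
  · exact hb
  · exact h.le f hf

theorem deg_pos (h : IsRootedTree m π) {w : ℕ} (hm : 0 < m) (hw : w ≤ m) :
    0 < (treeArcs π).deg m w := by
  rcases Nat.eq_zero_or_pos w with rfl | hw0
  · classical
    have hex := h.exists_iterate 1 hm
    obtain ⟨t, ht⟩ := Nat.exists_eq_succ_of_ne_zero (n := Nat.find hex) fun h0 => by
      simpa [h0] using Nat.find_spec hex
    obtain ⟨e, he⟩ := Nat.exists_eq_succ_of_ne_zero (Nat.find_min hex (m := t) (by omega))
    have hspec := Nat.find_spec hex
    rw [ht, Function.iterate_succ_apply', he, parent_succ] at hspec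
    exact Nat.add_pos_left (card_pos.2 ⟨e, mem_filter.2
      ⟨mem_range.2 (Nat.succ_le_iff.1 (he ▸ h.iterate_le hm t)), hspec⟩⟩) _
  · exact Nat.add_pos_right _ (card_pos.2 ⟨w - 1, mem_filter.2
      ⟨mem_range.2 (by omega), Nat.sub_add_cancel hw0⟩⟩)

theorem not_lt_of_iterate_eq_child (h : IsRootedTree m π) {b c e f t u : ℕ} (hb : b ≤ m)
    (he : π e = b) (hf : π f = b) (ht : (parent π)^[t] c = e + 1)
    (hu : (parent π)^[u] c = f + 1) : ¬ t < u := fun htu => by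
  have hfb : (parent π)^[u - t - 1] b = f + 1 := by
    rw [← he, ← parent_succ π e, ← ht, ← Function.iterate_succ_apply' (parent π),
      ← Function.iterate_add_apply, ← hu]
    congr 1
    omega
  have hbb : (parent π)^[u - t - 1 + 1] b = b := by
    rw [Function.iterate_succ_apply', hfb, parent_succ, hf]
  rw [h.eq_zero_of_periodic hb (Nat.succ_pos _) hbb, parent_iterate_zero] at hfb
  omega

theorem eq_of_iterate_eq_child (h : IsRootedTree m π) {b c e f t u : ℕ} (hb : b ≤ m)
    (he : π e = b) (hf : π f = b) (ht : (parent π)^[t] c = e + 1)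
    (hu : (parent π)^[u] c = f + 1) : e = f := by
  obtain rfl : t = u := le_antisymm (not_lt.1 (h.not_lt_of_iterate_eq_child hb hf he hu ht))
    (not_lt.1 (h.not_lt_of_iterate_eq_child hb he hf ht hu))
  exact Nat.succ_injective (ht.symm.trans hu)

end IsRootedTree

variable {D : Arcs ℕ} {k n m : ℕ} {π : ℕ → ℕ}

theorem deg_treeArcs (m : ℕ) (π : ℕ → ℕ) (w : ℕ) : (treeArcs π).deg m w =
    #{e ∈ range m | π e = w} + #{e ∈ range m | e + 1 = w} := rfl

theorem deg_treeArcs_update {e : ℕ} (he : e < m) (b y : ℕ) :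
    (treeArcs (Function.update π e b)).deg m y + (if π e = y then 1 else 0) =
      (treeArcs π).deg m y + if b = y then 1 else 0 := by
  simp only [deg_treeArcs, card_filter]
  rw [← add_sum_erase _ _ (mem_range.2 he),
    ← add_sum_erase (range m) (fun x => if π x = y then 1 else 0) (mem_range.2 he),
    sum_congr rfl fun x hx => by rw [Function.update_of_ne (ne_of_mem_erase hx)],
    Function.update_self]
  omega

/-- The sum of the amounts by which the degrees of a tree exceed `k`. -/
def excess (m k : ℕ) (π : ℕ → ℕ) : ℕ := ∑ w ∈ range (m + 1), ((treeArcs π).deg m w - k)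

theorem excess_le (m k : ℕ) (π : ℕ → ℕ) : excess m k π ≤ (m + 1) * (m + m) := by
  have : ∀ w ∈ range (m + 1), (treeArcs π).deg m w - k ≤ m + m := fun w _ =>
    (Nat.sub_le _ _).trans ((treeArcs π).deg_le m w)
  simpa [excess] using sum_le_card_nsmul _ _ _ this

theorem excess_update_lt {e b : ℕ} (he : e < m) (hπ : π e ≤ m)
    (hlt : k < (treeArcs π).deg m (π e)) (hb : (treeArcs π).deg m b < k) :
    excess m k (Function.update π e b) < excess m k π := by
  have hne : b ≠ π e := by rintro rfl; omega
  refine sum_lt_sum (fun y _ => ?_) ⟨π e, mem_range.2 (Nat.lt_succ_of_le hπ), ?_⟩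
  · have hdeg := deg_treeArcs_update (π := π) he b y
    rcases eq_or_ne b y with rfl | hy
    · rw [if_pos rfl, if_neg hne.symm] at hdeg
      omega
    · rw [if_neg hy] at hdeg
      omega
  · have hdeg := deg_treeArcs_update (π := π) he b (π e)
    rw [if_pos rfl, if_neg hne] at hdeg
    omega

/-- The vertex of which `w` is a copy, in a tree with root over `0` and with one copy of the head
of every edge. -/
def Arcs.over (D : Arcs ℕ) : ℕ → ℕ
  | 0 => 0
  | e + 1 => D.dst e

theorem Arcs.over_lt (hn : 0 < n) (hval : ∀ e < m, D.src e < n ∧ D.dst e < n) {w : ℕ}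
    (hw : w ≤ m) : D.over w < n := by
  cases w with
  | zero => exact hn
  | succ e => exact (hval e hw).2

theorem Arcs.Rooted.exists_over_eq (h : D.Rooted m n) {u : ℕ} (hu : u < n) :
    ∃ w ≤ m, D.over w = u := by
  rcases (h u hu).cases_tail with rfl | ⟨_, -, e, he, -, rfl⟩
  · exact ⟨0, Nat.zero_le _, rfl⟩
  · exact ⟨e + 1, he, rfl⟩

theorem Arcs.card_filter_over (D : Arcs ℕ) (m v : ℕ) :
    #{w ∈ range (m + 1) | D.over w = v} = D.copies m v := by
  rw [card_filter, sum_range_succ', Arcs.copies, Arcs.indeg, card_filter]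
  simp only [Arcs.over, eq_comm]

/-- The edges `treeArcs π` form a rooted tree and lie over the edges `D`. -/
structure IsTreeOver (D : Arcs ℕ) (m : ℕ) (π : ℕ → ℕ) : Prop extends IsRootedTree m π where
  over_eq : ∀ e < m, D.over (π e) = D.src e

/-- The edge `e` cannot be moved from a vertex of too large degree to `b`. -/
def Stuck (D : Arcs ℕ) (m k : ℕ) (π : ℕ → ℕ) (e b : ℕ) : Prop :=
  k < (treeArcs π).deg m (π e) → (treeArcs π).deg m b < k → D.over (π e) = D.over b →
    ∃ t, (parent π)^[t] b = e + 1

namespace IsTreeOver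

theorem map_same (h : IsTreeOver D m π) : ((treeArcs π).map D.over).Same m D := fun e he =>
  congrArg (s(·, D.dst e)) (h.over_eq e he)

theorem update (h : IsTreeOver D m π) {e b : ℕ} (hb : b ≤ m)
    (hanc : ∀ t, (parent π)^[t] b ≠ e + 1) (hover : D.over (π e) = D.over b) :
    IsTreeOver D m (Function.update π e b) where
  toIsRootedTree := h.toIsRootedTree.update hb hanc
  over_eq f hf := by
    rcases eq_or_ne f e with rfl | hfe
    · rw [Function.update_self, ← hover, h.over_eq f hf]
    · rw [Function.update_of_ne hfe, h.over_eq f hf]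

theorem sum_deg (h : IsTreeOver D m π) (v : ℕ) :
    ∑ w ∈ range (m + 1) with D.over w = v, (treeArcs π).deg m w = D.deg m v := by
  rw [← h.map_same.deg_eq, Arcs.deg_map]
  exact fun e he => ⟨mem_range.2 (Nat.lt_succ_of_le (h.le e he)),
    mem_range.2 (Nat.succ_lt_succ he)⟩

theorem exists_deg_lt (h : IsTreeOver D m π) {b : ℕ} (hb : b ≤ m)
    (hlt : k < (treeArcs π).deg m b)
    (hdeg : D.deg m (D.over b) ≤ k * D.copies m (D.over b)) :
    ∃ c ≤ m, D.over c = D.over b ∧ (treeArcs π).deg m c < k := by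
  by_contra! hcon
  have hsum := sum_lt_sum (s := {w ∈ range (m + 1) | D.over w = D.over b}) (f := fun _ => k)
    (g := (treeArcs π).deg m)
    (fun w hw => hcon w (mem_range_succ_iff.1 (mem_filter.1 hw).1) (mem_filter.1 hw).2)
    ⟨b, mem_filter.2 ⟨mem_range_succ_iff.2 hb, rfl⟩, hlt⟩
  rw [h.sum_deg, sum_const, D.card_filter_over, smul_eq_mul, mul_comm] at hsum
  exact hdeg.not_gt hsum

/-- A vertex `b` of too large degree has two children, and a vertex lies below at most one of
them. -/
theorem deg_le_of_stuck (h : IsTreeOver D m π) (hval : ∀ e < m, D.src e < n ∧ D.dst e < n)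
    (hn : 0 < n) (hdeg : ∀ v < n, D.deg m v ≤ k * D.copies m v)
    (hstuck : ∀ e < m, ∀ b < m + 1, Stuck D m k π e b) {b : ℕ} (hb : b ≤ m) :
    (treeArcs π).deg m b ≤ k := by
  by_contra! hlt
  obtain ⟨c, hc, hover, hck⟩ := h.exists_deg_lt hb hlt (hdeg _ (Arcs.over_lt hn hval hb))
  have hin : #{e ∈ range m | e + 1 = b} ≤ 1 := card_le_one.2 fun e he f hf => by
    simp only [mem_filter] at he hf
    omega
  have hm : 0 < m := Nat.pos_of_ne_zero fun hm => by simp [hm, deg_treeArcs] at hlt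
  have hk : 1 < k := lt_of_le_of_lt (h.deg_pos hm hc) hck
  have hout : 1 < #{e ∈ range m | π e = b} := by
    rw [deg_treeArcs] at hlt
    omega
  have hanc {e : ℕ} (he : e < m ∧ π e = b) : ∃ t, (parent π)^[t] c = e + 1 :=
    hstuck e he.1 c (Nat.lt_succ_of_le hc) (he.2 ▸ hlt) hck (by rw [he.2, hover])
  obtain ⟨e, he, f, hf, hef⟩ := one_lt_card.1 hout
  rw [mem_filter, mem_range] at he hf
  obtain ⟨t, ht⟩ := hanc he
  obtain ⟨u, hu⟩ := hanc hf
  exact hef (h.eq_of_iterate_eq_child hb he.2 hf.2 ht hu)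

end IsTreeOver

/-- The tail of every edge is attached to the copy of it that was reached first. -/
def firstPred (D : Arcs ℕ) (pr : ℕ → ℕ) (e : ℕ) : ℕ := if D.src e = 0 then 0 else pr (D.src e) + 1

theorem Marks.isTreeOver {rk pr : ℕ → ℕ} (h : Marks D n m 0 rk pr)
    (hval : ∀ e < m, D.src e < n ∧ D.dst e < n) (hrk : ∀ x < n, rk x ≠ 0)
    (hπ : ∀ e < m, π e = firstPred D pr e) : IsTreeOver D m π := by
  have hpred (e : ℕ) (he : e < m) : (D.src e = 0 ∧ π e = 0) ∨ (π e = pr (D.src e) + 1 ∧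
      pr (D.src e) < m ∧ D.dst (pr (D.src e)) = D.src e ∧
      rk (D.src (pr (D.src e))) < rk (D.src e)) := by
    rw [hπ e he, firstPred]
    by_cases h0 : D.src e = 0
    · exact .inl ⟨h0, if_pos h0⟩
    · have hp := (h.pred _ (hval e he).1 (hrk _ (hval e he).1)).resolve_left h0
      exact .inr ⟨if_neg h0, hp.1, hp.2.1, hp.2.2.2⟩
  have hroot (r : ℕ) : ∀ e < m, rk (D.src e) = r → ∃ t, (parent π)^[t] (e + 1) = 0 := by
    induction r using Nat.strong_induction_on with
    | _ r ih =>
      intro e he hr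
      rcases hpred e he with ⟨-, h0⟩ | ⟨hs, hlt, -, hrank⟩
      · exact ⟨1, h0⟩
      · obtain ⟨t, ht⟩ := ih _ (hr ▸ hrank) _ hlt rfl
        exact ⟨t + 1, by rw [Function.iterate_succ_apply, parent_succ, hs, ht]⟩
  refine ⟨⟨fun e he => ?_, fun w hw => ?_⟩, fun e he => ?_⟩
  · rcases hpred e he with ⟨-, h0⟩ | ⟨hs, hlt, -⟩ <;> omega
  · cases w with
    | zero => exact ⟨0, rfl⟩
    | succ e => exact hroot _ e hw rfl
  · rcases hpred e he with ⟨hs, h0⟩ | ⟨hs, -, hdst, -⟩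
    · rw [h0, hs, Arcs.over]
    · rw [hs, Arcs.over, hdst]

end TreesOver

section TreeSearch

/-! ### Finding the tree -/

variable {k n m L e b : ℕ} {D : Arcs ℕ} {π pr : ℕ → ℕ} {s s' : State} {P : Prog}

section Build

/-- Raise a flag if some vertex has too few copies. -/
def someDeficient : Prog :=
  .seq (.assign deficientFlag (.const 0)) <| .forTo deficientIdx regN <|
    .seq (count (.reg deficientIdx)) <| .cond (.sub (.reg countDegree) (.reg countCapacity))
      (.assign deficientFlag (.const 1)) .skip

theorem Holds.halts_someDeficient (h : Holds k n m D s) (hnL : n ≤ L) (hmL : m ≤ L) :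
    Halts L someDeficient s fun s' =>
      s'.reg deficientFlag = 0 ↔ ∀ v < n, D.deg m v ≤ k * D.copies m v := by
  refine .exec_seq rfl (.forTo (fun j s' => Holds k n m D s' ∧
    (s'.reg deficientFlag = 0 ↔ ∀ v < j, D.deg m v ≤ k * D.copies m v)) (h.setReg 0).n rfl hnL
    ⟨(h.setReg _).setReg _, by simp⟩ ?_ fun _ h => h.2)
  rintro j _ s' ⟨h, hflag⟩ hj -
  refine (h.halts_count hmL (.reg deficientIdx)).frame.seq fun s₁ ⟨⟨hcap, hdeg⟩, hf⟩ =>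
    .exec rfl ⟨((h.of_frame hf).of_frame (Frame.exec rfl s₁)).setReg _, ?_⟩
  simp only [Expr.eval, hj] at hcap hdeg
  rw [Nat.forall_lt_succ_right, ← hflag, ← hf.reg deficientFlag rfl, ← Nat.sub_eq_zero_iff_le]
  by_cases hle : D.deg m j - k * D.copies m j = 0 <;> simp [hcap, hdeg, hle]

/-- The memory contains the number `k`, the tree with edges `treeArcs π`, and the map from the
vertices of the tree to those of the graph `D`. -/
structure HoldsTree (k m : ℕ) (D : Arcs ℕ) (π : ℕ → ℕ) (s : State) : Prop where
  src : ∀ e < m, s.arr srcArr e = π e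
  dst : ∀ e < m, s.arr dstArr e = e + 1
  map : ∀ w ≤ m, s.arr mapArr w = D.over w
  k : s.reg regK = k
  n : s.reg regN = m + 1
  m : s.reg regM = m

theorem HoldsTree.setReg (h : HoldsTree k m D π s) {r : ℕ} (c : ℕ) (hr : 3 ≤ r := by decide) :
    HoldsTree k m D π (s.setReg r c) where
  src := h.src
  dst := h.dst
  map := h.map
  k := by rw [State.setReg_reg, if_neg (by omega), h.k]
  n := by rw [State.setReg_reg, if_neg (by omega), h.n]
  m := by rw [State.setReg_reg, if_neg (by omega), h.m]

theorem HoldsTree.of_frame (h : HoldsTree k m D π s) (hf : Frame P s s')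
    (hP : (P.keepsReg regK && P.keepsReg regN && P.keepsReg regM && P.keepsArr srcArr &&
      P.keepsArr dstArr && P.keepsArr mapArr) = true := by rfl) : HoldsTree k m D π s' := by
  simp only [Bool.and_eq_true] at hP
  obtain ⟨⟨⟨⟨⟨hk, hn⟩, hm⟩, hsrc⟩, hdst⟩, hmap⟩ := hP
  exact ⟨hf.arr _ hsrc ▸ h.src, hf.arr _ hdst ▸ h.dst, hf.arr _ hmap ▸ h.map,
    (hf.reg _ hk).trans h.k, (hf.reg _ hn).trans h.n, (hf.reg _ hm).trans h.m⟩

theorem HoldsTree.halts_count (h : HoldsTree k m D π s) (hL : m ≤ L) (x : Expr) :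
    Halts L (count x) s fun s' => s'.reg countDegree = (treeArcs π).deg m (x.eval s) := by
  have hsame : (arcsOf s).Same m (treeArcs π) := fun e he => by
    simp only [arcsOf, treeArcs, h.src e he, h.dst e he]
  refine (Holds.halts_count ⟨h.k, h.n, h.m, rfl⟩ hL x).mono fun s' hs' => ?_
  rw [hs'.2, hsame.deg_eq]

/-- Make the head of the edge in register `buildIdx` a new vertex, over the old head, and attach its
tail to the copy of the old tail that was reached first. -/
def buildStep : Prog :=
  .seq (.store mapArr (.add (.reg buildIdx) (.const 1)) (.get dstArr (.reg buildIdx))) <|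
  .seq (.store dstArr (.reg buildIdx) (.add (.reg buildIdx) (.const 1))) <|
  .cond (.get srcArr (.reg buildIdx))
    (.store srcArr (.reg buildIdx)
      (.add (.get predArr (.get srcArr (.reg buildIdx))) (.const 1))) .skip

/-- Replace the graph by a tree of which it is the homomorphic image. -/
def build : Prog :=
  .seq (reach (.const 0)) <| .seq (.store mapArr (.const 0) (.const 0)) <|
  .seq (.forTo buildIdx regM buildStep) (.assign regN (.add (.reg regM) (.const 1)))

/-- The first `j` edges have been replaced. -/
structure BuildInv (D : Arcs ℕ) (pr : ℕ → ℕ) (j : ℕ) (s : State) : Prop where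
  src : s.arr srcArr = fun e => if e < j then firstPred D pr e else D.src e
  dst : s.arr dstArr = fun e => if e < j then e + 1 else D.dst e
  map : ∀ w ≤ j, s.arr mapArr w = D.over w
  pred : s.arr predArr = pr

theorem BuildInv.exec_buildStep {j : ℕ} (h : BuildInv D pr j s) (hj : s.reg buildIdx = j) :
    BuildInv D pr (j + 1) (buildStep.exec s) := by
  have hsrc := congrFun h.src j
  have hdst := congrFun h.dst j
  simp only [lt_irrefl, if_false] at hsrc hdst
  refine ⟨?_, ?_, fun w hw => ?_, (Frame.exec rfl s).arr predArr rfl |>.trans h.pred⟩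
  · ext e
    rcases lt_trichotomy e j with he | rfl | he
    · by_cases h0 : D.src j = 0 <;>
        simp [buildStep, hj, hsrc, h0, he.ne, h.src, he, Nat.lt_succ_of_lt he]
    · by_cases h0 : D.src e = 0 <;> simp [buildStep, hj, hsrc, h0, firstPred, h.pred]
    · by_cases h0 : D.src j = 0 <;> simp [buildStep, hj, hsrc, h0, he.ne', h.src, he.not_gt,
        show ¬ e < j + 1 by omega]
  · ext e
    rcases lt_trichotomy e j with he | rfl | he
    · by_cases h0 : D.src j = 0 <;>
        simp [buildStep, hj, hsrc, h0, he.ne, h.dst, he, Nat.lt_succ_of_lt he]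
    · by_cases h0 : D.src e = 0 <;> simp [buildStep, hj, hsrc, h0]
    · by_cases h0 : D.src j = 0 <;> simp [buildStep, hj, hsrc, h0, he.ne', h.dst, he.not_gt,
        show ¬ e < j + 1 by omega]
  · rcases hw.lt_or_eq with hw | rfl
    · by_cases h0 : D.src j = 0 <;>
        simp [buildStep, hj, hsrc, h0, hw.ne, h.map w (Nat.le_of_lt_succ hw)]
    · by_cases h0 : D.src j = 0 <;> simp [buildStep, hj, hsrc, h0, hdst, Arcs.over]

theorem Holds.halts_build (h : Holds k n m D s) (hval : ∀ e < m, D.src e < n ∧ D.dst e < n)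
    (hn : 0 < n) (hroot : D.Rooted m n) (hnL : n ≤ L) (hmL : m ≤ L) :
    Halts L build s fun s' => ∃ π, HoldsTree k m D π s' ∧ IsTreeOver D m π := by
  refine (h.halts_reach hval (x := .const 0) hn hnL hmL).frame.seq
    fun s₁ ⟨⟨hmk, _, hreach⟩, hf₁⟩ => .exec_seq rfl ?_
  have h₁ := h.of_frame hf₁
  refine Halts.seq (Halts.frame (.forTo (BuildInv D (s₁.arr predArr)) h₁.m rfl hmL ?_
    (fun j _ s₂ hinv hj _ => ?_) fun _ h => h)) fun s₂ ⟨hinv, hf₂⟩ => .exec rfl ?_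
  · exact ⟨by simp [h₁.src], by simp [h₁.dst], fun w hw => by simp [Nat.le_zero.1 hw, Arcs.over],
      rfl⟩
  · have := hinv.exec_buildStep hj
    exact .exec rfl ⟨this.src, this.dst, this.map, this.pred⟩
  · have hm₂ : s₂.reg regM = m := (hf₂.reg _ rfl).trans h₁.m
    refine ⟨firstPred D (s₁.arr predArr), ⟨fun e he => ?_, fun e he => ?_, hinv.map, ?_, ?_, ?_⟩,
      hmk.isTreeOver hval (fun x hx => (hreach x hx).2 (hroot x hx)) fun _ _ => rfl⟩
    · simp [hinv.src, he]
    · simp [hinv.dst, he]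
    · simpa using (hf₂.reg regK rfl).trans h₁.k
    · simp [hm₂]
    · simpa using hm₂

end Build

section Move

/-- Follow the path from the vertex in register `innerIdx` to the root, and raise a flag if it
contains the child below the edge in register `outerIdx`. -/
def walk : Prog :=
  .seq (.seq (.assign walkFound (.const 0)) (.assign walkVertex (.reg innerIdx))) <|
  .forTo walkIdx regN <| .seq
    (.cond (.ne (.reg walkVertex) (.add (.reg outerIdx) (.const 1))) .skip
      (.assign walkFound (.const 1)))
    (.cond (.reg walkVertex)
      (.assign walkVertex (.get srcArr (.sub (.reg walkVertex) (.const 1)))) .skip)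

theorem HoldsTree.halts_walk (h : HoldsTree k m D π s) (hπ : IsRootedTree m π) (hb : b ≤ m)
    (hse : s.reg outerIdx = e) (hsb : s.reg innerIdx = b) (hL : m + 1 ≤ L) :
    Halts L walk s fun s' => s'.reg walkFound = 0 ↔ ∀ t, (parent π)^[t] b ≠ e + 1 := by
  rw [← hπ.forall_iterate_ne_iff hb e.succ_ne_zero]
  refine .exec_seq rfl (.forTo (fun j s' => s'.reg walkVertex = (parent π)^[j] b ∧
    (s'.reg walkFound = 0 ↔ ∀ t < j, (parent π)^[t] b ≠ e + 1)) (by simpa using h.n) rfl hL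
    (by simp [hsb]) ?_ fun _ h => h.2)
  rintro j _ s' ⟨hvertex, hfound⟩ - hf
  have he : s'.reg outerIdx = e := (hf.reg _ rfl).trans (by simpa using hse)
  have hsrc (f : ℕ) (hf' : f < m) : s'.arr srcArr f = π f :=
    (congrFun (hf.arr srcArr rfl) f).trans (h.src f hf')
  have hle := hπ.iterate_le hb j
  refine .exec rfl ⟨?_, ?_⟩
  · rw [Function.iterate_succ_apply']
    generalize (parent π)^[j] b = w at hvertex hle
    cases w with
    | zero => simp [hvertex, he, parent]
    | succ f => rcases eq_or_ne f e with rfl | hfe <;> simp [parent_succ, hsrc f hle, *]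
  · rw [Nat.forall_lt_succ_right, ← hfound, ← hvertex]
    by_cases h0 : s'.reg walkVertex = 0 <;> by_cases hw : s'.reg walkVertex = e + 1 <;>
      simp [h0, hw, he]

/-- Move the edge in register `outerIdx` to the vertex in register `innerIdx` if this is
possible. -/
def tryMove : Prog :=
  .cond (.ne (.get mapArr (.get srcArr (.reg outerIdx))) (.get mapArr (.reg innerIdx))) .skip <|
    .seq walk <| .cond (.reg walkFound) .skip <|
      .seq (.store srcArr (.reg outerIdx) (.reg innerIdx)) (.assign progressFlag (.const 1))

theorem HoldsTree.halts_tryMove (h : HoldsTree k m D π s) (hπ : IsTreeOver D m π) (he : e < m)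
    (hb : b ≤ m) (hse : s.reg outerIdx = e) (hsb : s.reg innerIdx = b) (hL : m + 1 ≤ L) :
    Halts L tryMove s fun s' =>
      (HoldsTree k m D (Function.update π e b) s' ∧ IsTreeOver D m (Function.update π e b) ∧
        s'.reg progressFlag = 1) ∨
      (HoldsTree k m D π s' ∧ s'.reg progressFlag = s.reg progressFlag ∧
        (D.over (π e) = D.over b → ∃ t, (parent π)^[t] b = e + 1)) := by
  refine .cond (fun hover => .exec rfl (.inr ⟨h, rfl, fun hover' => absurd ?_ hover⟩))
    fun hover => ?_
  · rw [Expr.eval_ne]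
    simpa [hse, hsb, h.src e he, h.map _ (hπ.le e he), h.map b hb] using hover'
  rw [Expr.eval_ne] at hover
  simp only [Expr.eval, hse, hsb, h.src e he, h.map _ (hπ.le e he), h.map b hb] at hover
  refine (h.halts_walk hπ.toIsRootedTree hb hse hsb hL).frame.seq fun s₁ ⟨hwalk, hf⟩ => ?_
  have h₁ := h.of_frame hf
  refine .cond (fun hfound => .exec rfl (.inr ⟨h₁, hf.reg _ rfl, fun _ => ?_⟩)) fun hfound =>
    .exec rfl (.inl ⟨⟨fun f hf' => ?_, ?_, ?_, ?_, ?_, ?_⟩, hπ.update hb (hwalk.1 hfound) hover,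
      ?_⟩)
  · simpa [hwalk] using hfound
  · simp [Function.update_apply, (hf.reg outerIdx rfl).trans hse,
      (hf.reg innerIdx rfl).trans hsb, h₁.src f hf']
  · simpa using h₁.dst
  · simpa using h₁.map
  · simpa using h₁.k
  · simpa using h₁.n
  · simpa using h₁.m
  · simp

/-- Move the edge in register `outerIdx` to the vertex in register `innerIdx` if this is possible
and decreases the excess. -/
def move : Prog :=
  .seq (count (.get srcArr (.reg outerIdx))) <| .cond (.sub (.reg countDegree) (.reg regK))
    (.seq (count (.reg innerIdx)) <| .cond (.sub (.reg regK) (.reg countDegree)) tryMove .skip)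
    .skip

theorem HoldsTree.halts_move (h : HoldsTree k m D π s) (hπ : IsTreeOver D m π) (he : e < m)
    (hb : b ≤ m) (hse : s.reg outerIdx = e) (hsb : s.reg innerIdx = b) (hL : m + 1 ≤ L) :
    Halts L move s (Progress (fun π s => HoldsTree k m D π s ∧ IsTreeOver D m π) (excess m k)
      progressFlag s π (Stuck D m k π e b)) := by
  refine (h.halts_count ((Nat.le_succ m).trans hL) _).frame.seq fun s₁ ⟨hdeg, hf₁⟩ => ?_
  have h₁ := h.of_frame hf₁
  simp only [Expr.eval, hse, h.src e he] at hdeg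
  refine .cond (fun hlt => ?_) fun hle => .exec rfl (.inr ⟨⟨h₁, hπ⟩, hf₁.reg _ rfl, fun hlt => ?_⟩)
  swap
  · simp only [Expr.eval, hdeg, h₁.k] at hle
    omega
  simp only [Expr.eval, hdeg, h₁.k] at hlt
  refine (h₁.halts_count ((Nat.le_succ m).trans hL) _).frame.seq fun s₂ ⟨hdeg, hf₂⟩ => ?_
  have h₂ := h₁.of_frame hf₂
  have hse₂ : s₂.reg outerIdx = e := ((hf₂.reg _ rfl).trans (hf₁.reg _ rfl)).trans hse
  have hsb₂ : s₂.reg innerIdx = b := ((hf₂.reg _ rfl).trans (hf₁.reg _ rfl)).trans hsb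
  have hfl₂ : s₂.reg progressFlag = s.reg progressFlag := (hf₂.reg _ rfl).trans (hf₁.reg _ rfl)
  simp only [Expr.eval, (hf₁.reg innerIdx rfl).trans hsb] at hdeg
  refine .cond (fun hlt' => ?_) fun hle => .exec rfl (.inr ⟨⟨h₂, hπ⟩, hfl₂, fun _ hlt' => ?_⟩)
  swap
  · simp only [Expr.eval, hdeg, h₂.k] at hle
    omega
  simp only [Expr.eval, hdeg, h₂.k] at hlt'
  refine (h₂.halts_tryMove hπ he hb hse₂ hsb₂ hL).mono fun s₃ h₃ => ?_
  rcases h₃ with ⟨h₃, hπ', hfl⟩ | ⟨h₃, hfl, hstuck⟩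
  · exact .inl ⟨_, ⟨h₃, hπ'⟩, excess_update_lt he (hπ.le e he) (by omega) (by omega), hfl⟩
  · exact .inr ⟨⟨h₃, hπ⟩, hfl.trans hfl₂, fun _ _ => hstuck⟩

/-- Move edges as long as this is possible and decreases the excess. -/
def moveAll : Prog := .search progressFlag <| .forTo outerIdx regM <| .forTo innerIdx regN move

theorem HoldsTree.halts_moveAll (h : HoldsTree k m D π s) (hπ : IsTreeOver D m π)
    (hmL : m + 1 ≤ L) (hL : (m + 1) * (m + m) < L) :
    Halts L moveAll s fun s' => ∃ π, HoldsTree k m D π s' ∧ IsTreeOver D m π ∧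
      ∀ e < m, ∀ b < m + 1, Stuck D m k π e b := by
  refine .search₂ (Rep := fun π s => HoldsTree k m D π s ∧ IsTreeOver D m π) (μ := excess m k)
    (F := fun π e b => Stuck D m k π e b) (fun r hr π s x h => ⟨h.1.setReg x ?_, h.2⟩)
    (fun π s h => h.1.m) (fun π s h => h.1.n) (by decide) (by decide) (by decide)
    ((Nat.le_succ m).trans hmL) hmL ?_ ⟨h, hπ⟩ ((excess_le m k π).trans_lt hL)
    fun π s h hF => ⟨π, h.1, h.2, hF⟩
  · simp only [List.mem_cons, List.not_mem_nil, or_false] at hr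
    omega
  · rintro e he b hb π s ⟨h, hπ⟩ hse hsb
    exact h.halts_move hπ he (Nat.le_of_lt_succ hb) hse hsb hmL

end Move

end TreeSearch

section Algorithm

/-! ### The algorithm -/

/-- Orient the graph such that all vertices are reachable from `0` and no copies can be traded. -/
def findOrientation : Prog := .seq orient tradeAll

/-- Replace the graph by a tree in which no edges can be moved. -/
def findTree : Prog := .seq build moveAll

/-- Decide whether the graph is a `k`-trail, and if so, replace it by a `k`-tree of which it is the
homomorphic image. -/
def recognize : Prog :=
  .seq findOrientation <| .seq someDeficient <| .cond (.reg deficientFlag)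
    (.assign regK (.const 0)) (.seq findTree (.assign regK (.const 1)))

variable {G : EdgeList} {k n m L : ℕ} {D : Arcs ℕ} {π : ℕ → ℕ} {s : State}

theorem holds_inputState (G : EdgeList) (k : ℕ) :
    Holds k G.n G.m G.arcs (inputState G k) where
  k := rfl
  n := rfl
  m := rfl
  arcs := by simp [arcsOf, inputState, EdgeList.arcs]

theorem Holds.halts_findOrientation (h : Holds k G.n G.m G.arcs s) (hk : 0 < k) (hn : 0 < G.n)
    (hconn : IsConnected G.toGraph) (hnL : G.n < L) (hmL : G.m ≤ L)
    (hL : G.n * (G.m + G.m) < L) :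
    Halts L findOrientation s fun s' => ∃ D, Holds k G.n G.m D s' ∧ D.Same G.m G.arcs ∧
      D.Rooted G.m G.n ∧ ∀ v < G.n, ∀ u < G.n, D.Blocked G.n G.m k v u := by
  have hval : ∀ e < G.m, G.arcs.src e < G.n ∧ G.arcs.dst e < G.n := fun e => G.arcs_lt
  refine (h.halts_orient hval hn hnL hmL).seq fun s₁ ⟨D, h₁, hsame, hclosed⟩ => ?_
  have hroot : D.Rooted G.m G.n := fun x hx =>
    EdgeList.mem_of_closed hconn hsame (S := {x | D.Reach G.m 0 x}) hn .refl
      (fun e he => ⟨fun h => h.tail ⟨e, he, rfl, rfl⟩, hclosed e he⟩) hx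
  exact h₁.halts_tradeAll hval hk hsame hroot hnL.le hmL hL

theorem Holds.halts_findTree (h : Holds k n m D s) (hval : ∀ e < m, D.src e < n ∧ D.dst e < n)
    (hn : 0 < n) (hroot : D.Rooted m n) (hdeg : ∀ v < n, D.deg m v ≤ k * D.copies m v)
    (hnL : n ≤ L) (hmL : m + 1 ≤ L) (hL : (m + 1) * (m + m) < L) :
    Halts L findTree s fun s' => ∃ π, HoldsTree k m D π s' ∧ IsTreeOver D m π ∧
      ∀ w ≤ m, (treeArcs π).deg m w ≤ k := by
  refine (h.halts_build hval hn hroot hnL ((Nat.le_succ m).trans hmL)).seq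
    fun s₁ ⟨_, h₁, hπ₁⟩ => (h₁.halts_moveAll hπ₁ hmL hL).mono fun s₂ ⟨π, h₂, hπ, hstuck⟩ =>
      ⟨π, h₂, hπ, fun w hw => hπ.deg_le_of_stuck hval hn hdeg hstuck hw⟩

theorem HoldsTree.exists_outputs (h : HoldsTree k G.m D π s) (hsame : D.Same G.m G.arcs)
    (hroot : D.Rooted G.m G.n) (hn : 0 < G.n) (hπ : IsTreeOver D G.m π)
    (hdeg : ∀ w ≤ G.m, (treeArcs π).deg G.m w ≤ k) (c : ℕ) :
    ∃ (H : EdgeList) (φ : Fin H.n → Fin G.n), Outputs (s.setReg regK c) H φ ∧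
      IsKTree H.toGraph k ∧ IsHomImageBy G.toGraph H.toGraph φ :=
  have hover : ∀ w ≤ G.m, D.over w < G.n := fun _ hw =>
    Arcs.over_lt hn (hsame.lt fun _ => G.arcs_lt) hw
  ⟨treeEdgeList G.m π hπ.le,
    fun w : Fin (G.m + 1) => (⟨D.over w, hover w (Nat.le_of_lt_succ w.2)⟩ : Fin G.n),
    ⟨h.n, h.m, fun e => ⟨h.src e e.2, h.dst e e.2⟩, fun w => h.map w (Nat.le_of_lt_succ w.2)⟩,
    hπ.isKTree hdeg, isHomImageBy_treeEdgeList hπ.le hover (fun _ hu => hroot.exists_over_eq hu)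
      (hπ.map_same.trans hsame)⟩

theorem halts_recognize (hk : 0 < k) (hn : 0 < G.n) (hconn : IsConnected G.toGraph)
    (hnL : G.n < L) (hmL : G.m + 1 ≤ L) (hL₁ : G.n * (G.m + G.m) < L)
    (hL₂ : (G.m + 1) * (G.m + G.m) < L) :
    Halts L recognize (inputState G k) fun s =>
      (s.reg regK = 0 ∧ ¬ IsKTrail G.toGraph k) ∨
      (s.reg regK = 1 ∧ ∃ (H : EdgeList) (φ : Fin H.n → Fin G.n),
        Outputs s H φ ∧ IsKTree H.toGraph k ∧ IsHomImageBy G.toGraph H.toGraph φ) := by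
  have hmL' : G.m ≤ L := (Nat.le_succ _).trans hmL
  refine ((holds_inputState G k).halts_findOrientation hk hn hconn hnL hmL' hL₁).seq
    fun s₁ ⟨D, h₁, hsame, hroot, hblocked⟩ => ?_
  refine (h₁.halts_someDeficient hnL.le hmL').frame.seq fun s₂ ⟨hmet, hf⟩ => .cond
    (fun hdef => .exec rfl (.inl ⟨rfl, ?_⟩)) fun hmet' => ?_
  · rw [Expr.eval, Ne, hmet] at hdef
    push Not at hdef
    obtain ⟨v, hv, hdef⟩ := hdef
    exact not_isKTrail_of_stuck hsame hroot hv hdef fun u hu => hblocked v hv u hu hdef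
  · exact ((h₁.of_frame hf).halts_findTree (hsame.lt fun _ => G.arcs_lt) hn hroot (hmet.1 hmet')
      hnL.le hmL hL₂).seq fun s₃ ⟨π, h₃, hπ, hdeg⟩ =>
        .exec rfl (.inr ⟨rfl, h₃.exists_outputs hsame hroot hn hπ hdeg 1⟩)

theorem IsKTree.isKTrail {H : EdgeList} {φ : Fin H.n → Fin G.n} (h : IsKTree H.toGraph k)
    (hφ : IsHomImageBy G.toGraph H.toGraph φ) : IsKTrail G.toGraph k :=
  ⟨_, _, H.toGraph, φ, Set.toFinite _, Set.toFinite _, h.1.2.connected, h.2, hφ⟩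

end Algorithm

end KTrail

/-- There are a program `P` and a polynomial `p` such that on every connected multigraph `G` with at
least two vertices and every `k > 0`, the program halts within time `p` of the length of the input.
If `G` is a `k`-trail, it answers `1` and outputs a `k`-tree `H` and a map `φ` by which `G` is the
homomorphic image of `H`; otherwise it answers `0`. -/
theorem theorem1 :
    ∃ (P : Ram.Prog) (p : Polynomial ℕ),
      ∀ (G : KTrail.EdgeList) (k : ℕ), 0 < k → 2 ≤ G.n → KTrail.IsConnected G.toGraph →
        ∃ (t : ℕ) (s : Ram.State),
          Ram.Runs P (KTrail.inputState G k) t s ∧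
          t ≤ p.eval (KTrail.inputSize G k) ∧
          (KTrail.IsKTrail G.toGraph k →
            s.reg 0 = 1 ∧
            ∃ (H : KTrail.EdgeList) (φ : Fin H.n → Fin G.n),
              KTrail.Outputs s H φ ∧
              KTrail.IsKTree H.toGraph k ∧
              KTrail.IsHomImageBy G.toGraph H.toGraph φ) ∧
          (¬ KTrail.IsKTrail G.toGraph k → s.reg 0 = 0) := by
  refine ⟨KTrail.recognize,
    KTrail.recognize.time (2 * (Polynomial.X + 1) * (Polynomial.X + 1) : Polynomial ℕ),
    fun G k hk hn hconn => ?_⟩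
  set N := KTrail.inputSize G k with hN
  have hle : G.n ≤ N ∧ G.m ≤ N := by rw [hN, KTrail.inputSize]; omega
  obtain ⟨t, s, hruns, ht, hs⟩ := KTrail.halts_recognize (L := 2 * (N + 1) * (N + 1)) (G := G) hk
    (by omega) hconn (by nlinarith) (by nlinarith) (by nlinarith) (by nlinarith)
  refine ⟨t, s, hruns, ?_, ?_⟩
  · rw [Ram.Prog.eval_time]
    simpa using ht
  rcases hs with ⟨hno, hnot⟩ | ⟨hyes, H, φ, hout, htree, hhom⟩
  · exact ⟨fun h => absurd h hnot, fun _ => hno⟩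
  · exact ⟨fun _ => ⟨hyes, H, φ, hout, htree, hhom⟩, fun h => absurd (htree.isKTrail hhom) h⟩
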